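/- Let $\mathbb S^n$ be the space of real symmetric $n\times n$ matrices with the inner product $C\bullet X=\sum_{i,j}C_{ij}X_{ij}$. Let $C\in\mathbb S^n$, let $\mathcal A:\mathbb S^n\to\mathbb R^m$ and $\mathcal Q_h:\mathbb S^n\to\mathbb R^{n_h}$ $(h=1,\dots,H)$ be arbitrary linear maps with adjoints $\mathcal A^\top,\mathcal Q_h^\top$, and let $b\in\mathbb R^m$, $\mu>0$, $\lambda_h\ge 0$ and $p_h\in[1,\infty]$, with $p_h^*$ given by $1/p_h+1/p_h^*=1$. Consider the problem $$(\mathcal P)\quad \min_{X\in\mathbb S^n}\ C\bullet X-\mu\log\det X+\sum_{h=1}^H\lambda_h\|\mathcal Q_h(X)\|_{p_h}\quad\text{s.t. } \mathcal A(X)=b,\ X\succ O.$$ On the space $\mathcal U=\mathbb R^m\times(\mathbb S^n)^H$ of variables $U=(y,S_1,\dots,S_H)$, with the product inner product $\langle\cdot,\cdot\rangle$ and its norm, put $\mathcal B(U)=-\mathcal A^\top(y)+\sum_h S_h$, $\mathcal S_h=\{\mathcal Q_h^\top(z):\|z\|_{p_h^*}\le\lambda_h\}$, $\mathcal M=\{U: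 S_h\in\mathcal S_h\ \text{for all } h\}$ and $\mathcal F=\{U\in\mathcal M: C+\mathcal B(U)\succ O\}$. The dual problem is $$(\mathcal D)\quad \max_{U\in\mathcal F}\ g(U):=b^\top y+\mu\log\det(C+\mathcal B(U))+n\mu-n\mu\log\mu.$$ Assume that $\mathcal A$ is surjective, that there is $\widehat X\succ O$ with $\mathcal A(\widehat X)=b$, and that $\mathcal F\neq\emptyset$. **Algorithm** (generalized DSPG method). Let $P_{\mathcal M}$ denote the metric projection onto $\mathcal M$. Choose $\tau,\gamma,\beta\in(0,1)$, $0<\alpha_{\min}<\alpha_{\max}<\infty$, an integer $M>0$, a stopping parameter $\varepsilon$, $U^0\in\mathcal F$ and $\alpha_0\in[\alpha_{\min},\alpha_{\max}]$. For $k=0,1,2,\dots$: 1. If $\|P_{\mathcal M}(U^k+\nabla g(U^k))-U^k\|\le\varepsilon$, terminate. 2. Let $D^k=P_{\mathcal M}(U^k+\alpha_k\nabla g(U^k))-U^k$, let $L_k$ be the Cholesky factor of $C+\mathcal B(U^k)$ (so $L_kL_k^\top=C+\mathcal B(U^k)$), and let $\theta$ be the smallest eigenvalue of $L_k^{-1}\mathcal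 B(D^k)(L_k^\top)^{-1}$. Put $\nu_k=1$ if $\theta\ge0$ and $\nu_k=\min\{1,-\tau/\theta\}$ otherwise. Let $\sigma_k$ be the largest element of $\{1,\beta,\beta^2,\dots\}$ such that $$g(U^k+\sigma_k\nu_kD^k)\ \ge\ \min_{\max\{0,k-M+1\}\le l\le k}g(U^l)+\gamma\sigma_k\nu_k\langle\nabla g(U^k),D^k\rangle .$$ 3. Let $U^{k+1}=U^k+\sigma_k\nu_kD^k$ and $p_k=\langle U^{k+1}-U^k,\nabla g(U^{k+1})-\nabla g(U^k)\rangle$. Put $\alpha_{k+1}=\alpha_{\max}$ if $p_k\ge0$ and $\alpha_{k+1}=\min\{\alpha_{\max},\max\{\alpha_{\min},-\|U^{k+1}-U^k\|^2/p_k\}\}$ otherwise. **Theorem.** The dual problem $(\mathcal D)$ attains a finite optimal value $g^*$. For every choice of the parameters and starting data, the algorithm with $\varepsilon=0$ is well defined (a complete run, finite or infinite, exists), all its iterates lie in $\mathcal F$, and either it terminates at an iterate $U^K$ with $g(U^K)=g^*$, or it generates an infinite sequence $\{U^k\}$ with $$\lim_{k\to\infty}|g(U^k)-g^*|=0.$$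 -/

import Mathlib

open scoped ENNReal

/-- The Euclidean space `𝕊ⁿ` of real symmetric `n × n` matrices. It inherits from
`EuclideanSpace ℝ (Fin n × Fin n)` the inner product `C • X = ∑ i, ∑ j, C i j * X i j`
and hence the Frobenius norm. -/
def SymMat (n : ℕ) : Submodule ℝ (EuclideanSpace ℝ (Fin n × Fin n)) where
  carrier := {X | ∀ i j, X (i, j) = X (j, i)}
  add_mem' := by
    intro X Y hX hY i j
    simp only [PiLp.add_apply]
    rw [hX i j, hY i j]
  zero_mem' := by
    intro i j
    simp
  smul_mem' := by
    intro c X hX i j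
    simp only [PiLp.smul_apply]
    rw [hX i j]

/-- The matrix of an element of `𝕊ⁿ`. -/
def symToMatrix {n : ℕ} (X : SymMat n) : Matrix (Fin n) (Fin n) ℝ :=
  Matrix.of fun i j => (X : EuclideanSpace ℝ (Fin n × Fin n)) (i, j)

/-- The `ℓ_p`-norm of a vector of `ℝᵈ`, for `p ∈ [1, ∞]`. -/
noncomputable def lpNormVec {d : ℕ} (p : ℝ≥0∞) (z : EuclideanSpace ℝ (Fin d)) : ℝ :=
  ‖(WithLp.toLp p (WithLp.ofLp z) : PiLp p fun _ : Fin d => ℝ)‖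

/-- `P` is a nearest point to `x` in `S`, that is, `P = argmin_{v ∈ S} ‖v - x‖` (the minimizer
is unique when `S` is convex). -/
def IsProjOnto {E : Type*} [NormedAddCommGroup E] (S : Set E) (x P : E) : Prop :=
  P ∈ S ∧ ∀ v ∈ S, ‖P - x‖ ≤ ‖v - x‖

/-- The data of the generalized log-det semidefinite program
`min  C • X - μ log det X + ∑ h, λ_h ‖Q_h X‖_{p_h}  s.t.  A X = b, X ≻ 0` over `X ∈ 𝕊ⁿ`. -/
structure LogDetSDP where
  /-- the order of the matrices -/
  n : ℕ
  /-- the number of equality constraints -/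
  m : ℕ
  /-- the number of norm terms -/
  H : ℕ
  /-- the dimension of the target of `Q h` -/
  d : Fin H → ℕ
  C : SymMat n
  A : SymMat n →ₗ[ℝ] EuclideanSpace ℝ (Fin m)
  b : EuclideanSpace ℝ (Fin m)
  Q : (h : Fin H) → (SymMat n →ₗ[ℝ] EuclideanSpace ℝ (Fin (d h)))
  p : Fin H → ℝ≥0∞
  one_le_p : ∀ h, 1 ≤ p h
  lam : Fin H → ℝ
  lam_nonneg : ∀ h, 0 ≤ lam h
  mu : ℝ
  mu_pos : 0 < mu

namespace LogDetSDP

/-- Strict feasibility for the primal problem: `A X = b` and `X ≻ 0`. -/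
def PrimalStrictlyFeasible (P : LogDetSDP) (X : SymMat P.n) : Prop :=
  P.A X = P.b ∧ (symToMatrix X).PosDef

/-- The Euclidean product space `ℝᵐ × 𝕊ⁿ × ⋯ × 𝕊ⁿ` (with `H` factors `𝕊ⁿ`) of the dual
variables `U = (y, S₁, …, S_H)`, where `y = U.fst` and `S_h = U.snd h`; its inner product is the
sum of the inner products of the components. -/
abbrev DualSpace (P : LogDetSDP) : Type :=
  WithLp 2 (EuclideanSpace ℝ (Fin P.m) × PiLp 2 fun _ : Fin P.H => SymMat P.n)

/-- `𝓑(U) = - Aᵀ y + ∑ h, S_h`. -/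
noncomputable def calB (P : LogDetSDP) (U : P.DualSpace) : SymMat P.n :=
  - LinearMap.adjoint P.A U.fst + ∑ h, U.snd h

/-- The dual objective
`g(U) = bᵀ y + μ log det (C - Aᵀ y + ∑ h, S_h) + n μ - n μ log μ`. -/
noncomputable def g (P : LogDetSDP) (U : P.DualSpace) : ℝ :=
  inner ℝ P.b U.fst + P.mu * Real.log (symToMatrix (P.C + P.calB U)).det
    + P.n * P.mu - P.n * P.mu * Real.log P.mu

/-- `𝒮_h = {Q_hᵀ z : ‖z‖_{p_h^*} ≤ λ_h}`, where `1 / p_h + 1 / p_h^* = 1`. -/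
def calS (P : LogDetSDP) (h : Fin P.H) : Set (SymMat P.n) :=
  {S | ∃ z : EuclideanSpace ℝ (Fin (P.d h)),
    lpNormVec (ENNReal.conjExponent (P.p h)) z ≤ P.lam h ∧ S = LinearMap.adjoint (P.Q h) z}

/-- `𝓜 = {U : S_h ∈ 𝒮_h for all h}`. -/
def calM (P : LogDetSDP) : Set P.DualSpace := {U | ∀ h, U.snd h ∈ P.calS h}

/-- `𝓝 = {U : C - Aᵀ y + ∑ h, S_h ≻ 0}`. -/
def calN (P : LogDetSDP) : Set P.DualSpace := {U | (symToMatrix (P.C + P.calB U)).PosDef}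

/-- The dual feasible region `𝓕 = 𝓜 ∩ 𝓝`. -/
def dualFeasible (P : LogDetSDP) : Set P.DualSpace := P.calM ∩ P.calN

end LogDetSDP

/-- The lower triangular matrix `L` with positive diagonal is the Cholesky factor of `Z`. -/
def IsCholesky {n : ℕ} (Z L : Matrix (Fin n) (Fin n) ℝ) : Prop :=
  (∀ i j, i < j → L i j = 0) ∧ (∀ i, 0 < L i i) ∧ L * L.transpose = Z

/-- `θ` is the smallest (real) eigenvalue of `W`. -/
def IsMinEigenvalue {n : ℕ} (W : Matrix (Fin n) (Fin n) ℝ) (θ : ℝ) : Prop :=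
  IsLeast {t : ℝ | Module.End.HasEigenvalue (Matrix.toLin' W) t} θ

/-- The parameters of the algorithm other than the stopping parameter. -/
structure DSPGParams where
  τ : ℝ
  τ_pos : 0 < τ
  τ_lt_one : τ < 1
  γ : ℝ
  γ_pos : 0 < γ
  γ_lt_one : γ < 1
  β : ℝ
  β_pos : 0 < β
  β_lt_one : β < 1
  αmin : ℝ
  αmin_pos : 0 < αmin
  αmax : ℝ
  αmin_lt_αmax : αmin < αmax
  M : ℕ
  M_pos : 0 < M

namespace LogDetSDP

/-- The stopping test at `U`: `‖P_𝓜(U + ∇g(U)) - U‖ ≤ ε`. -/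
def Stops (P : LogDetSDP) (ε : ℝ) (U : P.DualSpace) : Prop :=
  ∃ V, IsProjOnto P.calM (U + gradient P.g U) V ∧ ‖V - U‖ ≤ ε

/-- The stopping test at `U` fails: `‖P_𝓜(U + ∇g(U)) - U‖ > ε`. -/
def Continues (P : LogDetSDP) (ε : ℝ) (U : P.DualSpace) : Prop :=
  ∃ V, IsProjOnto P.calM (U + gradient P.g U) V ∧ ε < ‖V - U‖

/-- `min g(U^l)` over `[k - M + 1]₊ ≤ l ≤ k`. -/
noncomputable def windowMin (P : LogDetSDP) (par : DSPGParams) (U : ℕ → P.DualSpace) (k : ℕ) : ℝ :=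
  (Finset.Icc (k + 1 - par.M) k).inf'
    (Finset.nonempty_Icc.mpr (by have := par.M_pos; omega)) fun l => P.g (U l)

/-- The step adjustment: `ν = 1` if `θ ≥ 0`, and `ν = min {1, -τ/θ}` otherwise. -/
noncomputable def nuOf (par : DSPGParams) (θ : ℝ) : ℝ :=
  if 0 ≤ θ then 1 else min 1 (-par.τ / θ)

/-- The acceptance test of the nonmonotone line search in iteration `k`, with search direction `D`,
step adjustment `ν` and trial value `σ`. -/
def Armijo (P : LogDetSDP) (par : DSPGParams) (U : ℕ → P.DualSpace) (k : ℕ) (D : P.DualSpace)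
    (ν σ : ℝ) : Prop :=
  P.windowMin par U k + par.γ * σ * ν * inner ℝ (gradient P.g (U k)) D
    ≤ P.g (U k + (σ * ν) • D)

/-- The next (Barzilai–Borwein) step size after moving from `U` to `U'`, where
`p = ⟨U' - U, ∇g(U') - ∇g(U)⟩`. -/
noncomputable def nextAlpha (P : LogDetSDP) (par : DSPGParams) (U U' : P.DualSpace) : ℝ :=
  let p : ℝ := inner ℝ (U' - U) (gradient P.g U' - gradient P.g U)
  if 0 ≤ p then par.αmax else min par.αmax (max par.αmin (-‖U' - U‖ ^ 2 / p))

/-- Iteration `k` of the algorithm (after the stopping test has failed), which computes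
`U (k + 1)` and `α (k + 1)`: the direction `D = P_𝓜(U^k + α_k ∇g(U^k)) - U^k`, the Cholesky factor
`L` of `C + 𝓑(U^k)`, the least eigenvalue `θ` of `L⁻¹ 𝓑(D) L⁻ᵀ`, the step adjustment `ν`, and the
largest `σ = β ^ j` that passes the acceptance test. -/
def IsStep (P : LogDetSDP) (par : DSPGParams) (U : ℕ → P.DualSpace) (α : ℕ → ℝ) (k : ℕ) : Prop :=
  ∃ (V D : P.DualSpace) (L : Matrix (Fin P.n) (Fin P.n) ℝ) (θ ν : ℝ) (j : ℕ),
    IsProjOnto P.calM (U k + α k • gradient P.g (U k)) V ∧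
    D = V - U k ∧
    IsCholesky (symToMatrix (P.C + P.calB (U k))) L ∧
    IsMinEigenvalue (L⁻¹ * symToMatrix (P.calB D) * (L.transpose)⁻¹) θ ∧
    ν = nuOf par θ ∧
    P.Armijo par U k D ν (par.β ^ j) ∧
    (∀ i < j, ¬ P.Armijo par U k D ν (par.β ^ i)) ∧
    U (k + 1) = U k + (par.β ^ j * ν) • D ∧
    α (k + 1) = P.nextAlpha par (U k) (U (k + 1))

/-- A complete run of the algorithm from `U0` and `α0` with stopping parameter `ε`.
`N` is the number of iterations: if `N` is finite, the run is `U 0, …, U N` and terminates at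
`U N` (later entries of the sequences are irrelevant); if `N = ⊤`, it never terminates. -/
structure IsRun (P : LogDetSDP) (par : DSPGParams) (ε : ℝ) (U0 : P.DualSpace) (α0 : ℝ)
    (N : ℕ∞) (U : ℕ → P.DualSpace) (α : ℕ → ℝ) : Prop where
  init_U : U 0 = U0
  init_α : α 0 = α0
  continues : ∀ k : ℕ, (k : ℕ∞) < N → P.Continues ε (U k)
  step : ∀ k : ℕ, (k : ℕ∞) < N → P.IsStep par U α k
  stops : ∀ k : ℕ, (k : ℕ∞) = N → P.Stops ε (U k)

end LogDetSDP

/-! On the set where the slack `C + 𝓑(U)` is positive definite, `g` is concave with continuous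
gradient, so the method is projected gradient ascent for a smooth concave function. Three facts
carry the proof.

Compactness (`isCompact_superlevel`): a strictly feasible primal point makes `g` coercive in the
slack, the sets `𝒮_h` are compact, and surjectivity of `A` recovers `y` from `Aᵀ y`. Hence
superlevel sets of `g` in `𝓕` are compact. This gives attainment, and it confines the iterates,
because the window minimum never falls below `g(U⁰)`.

Uniform progress (`exists_uniform_progress`): on such a compact set, if `U^k` is not `η`-optimal,
concavity bounds `‖D^k‖` from below, and uniform continuity of the gradient bounds the accepted step
length from below. The predicted gain `t⟨∇g, D⟩` is then at least a fixed `δ₀`. Conversely, a gain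
below `δ₀` means that `U^k` is nearly optimal and the step is short, so `U^{k+1}` is nearly optimal
too. Thus each new value either exceeds the window minimum by a fixed amount or is at least `g* -
2η`.

Window argument (`eventually_le_of_window`): under this dichotomy a bound valid on a full window
improves by a fixed amount until it reaches `g* - 2η`. This gives convergence of the whole sequence
of values despite the nonmonotone search. -/

/-! ### Cholesky factors, least eigenvalues and concavity of `log det`. -/

section MatrixFacts

open Matrix

variable {n : ℕ}

theorem IsCholesky.isUnit {Z L : Matrix (Fin n) (Fin n) ℝ} (h : IsCholesky Z L) : IsUnit L := by
  rw [Matrix.isUnit_iff_isUnit_det, Matrix.det_of_isLowerTriangular L (fun i j hij => h.1 i j hij)]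
  exact (Finset.prod_pos fun i _ => h.2.1 i).ne'.isUnit

theorem Matrix.PosDef.exists_isCholesky {Z : Matrix (Fin n) (Fin n) ℝ} (hZ : Z.PosDef) :
    ∃ L, IsCholesky Z L := by
  have hlow : ∀ i j, i < j → LDL.lower hZ i j = 0 := by
    have : (LDL.lowerInv hZ).BlockTriangular OrderDual.toDual :=
      fun i j hij => LDL.lowerInv_triangular hZ hij
    exact fun i j hij => Matrix.blockTriangular_inv_of_blockTriangular this hij
  have hdet : IsUnit (LDL.lower hZ).det := Matrix.isUnit_nonsing_inv_det _
    ((Matrix.isUnit_iff_isUnit_det _).1 (isUnit_of_invertible _))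
  have hdiag : ∀ i, LDL.lower hZ i i ≠ 0 := by
    rw [Matrix.det_of_isLowerTriangular _ (fun i j hij => hlow i j hij)] at hdet
    exact fun i => Finset.prod_ne_zero_iff.1 hdet.ne_zero i (Finset.mem_univ i)
  have hpos : ∀ i, 0 < LDL.diagEntries hZ i := by
    have : (LDL.diag hZ).PosDef := by
      rw [LDL.diag_eq_lowerInv_conj]
      exact (Matrix.IsUnit.posDef_star_right_conjugate_iff (isUnit_of_invertible _)).2 hZ
    exact Matrix.posDef_diagonal_iff.1 this
  set L := LDL.lower hZ with hL
  set d := LDL.diagEntries hZ with hd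
  -- The square root of the diagonal part is absorbed into the columns of the lower factor; the
  -- signs make the diagonal positive.
  let s : Fin n → ℝ := fun i => SignType.sign (L i i) * √(d i)
  have hs : ∀ i, s i * s i = d i := by
    intro i
    have h1 : ((SignType.sign (L i i) : SignType) : ℝ) * (SignType.sign (L i i) : SignType) = 1 := by
      rcases lt_or_gt_of_ne (hdiag i) with h | h <;> simp [h]
    calc s i * s i = (((SignType.sign (L i i) : SignType) : ℝ) * (SignType.sign (L i i) : SignType))
          * (√(d i) * √(d i)) := by simp only [s]; ring
      _ = d i := by rw [h1, one_mul, Real.mul_self_sqrt (hpos i).le]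
  refine ⟨L * Matrix.diagonal s, ?_, ?_, ?_⟩
  · intro i j hij
    rw [Matrix.mul_diagonal, hlow i j hij, zero_mul]
  · intro i
    rw [Matrix.mul_diagonal]
    simp only [s]
    rw [← mul_assoc, self_mul_sign]
    exact mul_pos (abs_pos.2 (hdiag i)) (Real.sqrt_pos.2 (hpos i))
  · have h := LDL.lower_conj_diag hZ
    rw [Matrix.transpose_mul, Matrix.diagonal_transpose, Matrix.mul_assoc,
      ← Matrix.mul_assoc (Matrix.diagonal s), Matrix.diagonal_mul_diagonal, funext hs,
      ← Matrix.mul_assoc]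
    rw [← Matrix.conjTranspose_eq_transpose_of_trivial]
    exact h

theorem Matrix.IsHermitian.hasEigenvalue_iff {W : Matrix (Fin n) (Fin n) ℝ} (hW : W.IsHermitian)
    {t : ℝ} : Module.End.HasEigenvalue (Matrix.toLin' W) t ↔ ∃ i, hW.eigenvalues i = t := by
  rw [Module.End.hasEigenvalue_iff_mem_spectrum, Matrix.spectrum_toLin',
    hW.spectrum_real_eq_range_eigenvalues, Set.mem_range]

theorem Matrix.IsHermitian.exists_isMinEigenvalue [NeZero n] {W : Matrix (Fin n) (Fin n) ℝ}
    (hW : W.IsHermitian) : ∃ θ, IsMinEigenvalue W θ := by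
  obtain ⟨i, hi⟩ := Finite.exists_min hW.eigenvalues
  refine ⟨hW.eigenvalues i, hW.hasEigenvalue_iff.2 ⟨i, rfl⟩, fun t ht => ?_⟩
  obtain ⟨j, rfl⟩ := hW.hasEigenvalue_iff.1 ht
  exact hi j

theorem IsMinEigenvalue.posDef_one_add_smul_iff {W : Matrix (Fin n) (Fin n) ℝ} {θ t : ℝ}
    (hW : W.IsHermitian) (h : IsMinEigenvalue W θ) (ht : 0 ≤ t) :
    (1 + t • W).PosDef ↔ 0 < 1 + t * θ := by
  have key : (1 + t • W).PosDef ↔ ∀ i, 0 < 1 + t * hW.eigenvalues i := by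
    have h1 : 1 + t • W = (hW.eigenvectorUnitary : Matrix (Fin n) (Fin n) ℝ) *
        Matrix.diagonal (fun i => 1 + t * hW.eigenvalues i) *
        star (hW.eigenvectorUnitary : Matrix (Fin n) (Fin n) ℝ) := by
      have h2 : Matrix.diagonal (fun i => 1 + t * hW.eigenvalues i)
          = 1 + t • Matrix.diagonal (hW.eigenvalues) := by
        ext i j
        by_cases hij : i = j
        · subst hij; simp
        · simp [hij]
      have h3 := hW.spectral_theorem
      rw [Unitary.conjStarAlgAut_apply] at h3
      rw [h2, mul_add, add_mul, mul_one, Matrix.mul_smul, Matrix.smul_mul]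
      congr 1
      · exact (Unitary.mul_star_self_of_mem hW.eigenvectorUnitary.2).symm
      · congr 1
    have hu : IsUnit (hW.eigenvectorUnitary : Matrix (Fin n) (Fin n) ℝ) :=
      (Unitary.toUnits hW.eigenvectorUnitary).isUnit
    rw [h1, Matrix.IsUnit.posDef_star_right_conjugate_iff hu, Matrix.posDef_diagonal_iff]
  rw [key]
  obtain ⟨i, hi⟩ := hW.hasEigenvalue_iff.1 h.1
  constructor
  · intro hh
    rw [← hi]
    exact hh i
  · intro hh j
    have := h.2 (hW.hasEigenvalue_iff.2 ⟨j, rfl⟩)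
    nlinarith [mul_le_mul_of_nonneg_left this ht]

theorem Matrix.IsHermitian.whitening {L B : Matrix (Fin n) (Fin n) ℝ} (hB : B.IsHermitian) :
    (L⁻¹ * B * L.transpose⁻¹).IsHermitian := by
  rw [← Matrix.transpose_nonsing_inv, ← Matrix.conjTranspose_eq_transpose_of_trivial]
  exact Matrix.isHermitian_mul_mul_conjTranspose _ hB

theorem IsCholesky.eq_mul_whitening {Z L B : Matrix (Fin n) (Fin n) ℝ} (h : IsCholesky Z L) :
    B = L * (L⁻¹ * B * L.transpose⁻¹) * star L := by
  have hL := (Matrix.isUnit_iff_isUnit_det _).1 h.isUnit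
  have hL' : IsUnit L.transpose.det := by rwa [Matrix.det_transpose]
  rw [Matrix.star_eq_conjTranspose, Matrix.conjTranspose_eq_transpose_of_trivial,
    Matrix.mul_assoc, Matrix.mul_assoc, Matrix.nonsing_inv_mul _ hL', Matrix.mul_one,
    ← Matrix.mul_assoc, Matrix.mul_nonsing_inv _ hL, Matrix.one_mul]

/-- Congruence by `L` turns `1 + t • W`, with `W` the whitened `B`, into `Z + t • B`. So `θ`
determines exactly how far one may move along `B` without losing definiteness. -/
theorem IsCholesky.posDef_add_smul_iff {Z L B : Matrix (Fin n) (Fin n) ℝ} {θ t : ℝ}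
    (hB : B.IsHermitian) (h : IsCholesky Z L)
    (hθ : IsMinEigenvalue (L⁻¹ * B * L.transpose⁻¹) θ) (ht : 0 ≤ t) :
    (Z + t • B).PosDef ↔ 0 < 1 + t * θ := by
  rw [← hθ.posDef_one_add_smul_iff hB.whitening ht,
    ← Matrix.IsUnit.posDef_star_right_conjugate_iff (x := 1 + t • _) h.isUnit]
  congr! 1
  rw [Matrix.mul_add, Matrix.add_mul, Matrix.mul_smul, Matrix.smul_mul, ← h.eq_mul_whitening,
    Matrix.mul_one, Matrix.star_eq_conjTranspose, Matrix.conjTranspose_eq_transpose_of_trivial,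
    h.2.2]

theorem Matrix.PosDef.log_det_le_trace {W : Matrix (Fin n) (Fin n) ℝ} (hW : W.PosDef) :
    Real.log W.det ≤ W.trace - n := by
  rw [hW.1.det_eq_prod_eigenvalues, hW.1.trace_eq_sum_eigenvalues]
  simp only [RCLike.ofReal_real_eq_id, id_eq]
  rw [Real.log_prod fun i _ => (hW.eigenvalues_pos i).ne']
  calc ∑ i, Real.log (hW.1.eigenvalues i) ≤ ∑ i, (hW.1.eigenvalues i - 1) :=
        Finset.sum_le_sum fun i _ => Real.log_le_sub_one_of_pos (hW.eigenvalues_pos i)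
    _ = _ := by simp

/-- Concavity of `log det`, as a first-order inequality. -/
theorem Matrix.PosDef.log_det_le {Z Z' : Matrix (Fin n) (Fin n) ℝ} (hZ : Z.PosDef)
    (hZ' : Z'.PosDef) : Real.log Z'.det ≤ Real.log Z.det + (Z⁻¹ * (Z' - Z)).trace := by
  -- Whitening by the Cholesky factor of `Z` reduces the claim to the tangent inequality at the
  -- identity, which is `log x ≤ x - 1` on eigenvalues.
  obtain ⟨L, hL⟩ := hZ.exists_isCholesky
  have hLd := (Matrix.isUnit_iff_isUnit_det _).1 hL.isUnit
  have h1 := hL.eq_mul_whitening (B := Z')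
  have hW : (L⁻¹ * Z' * L.transpose⁻¹).PosDef := by
    rw [← Matrix.IsUnit.posDef_star_right_conjugate_iff hL.isUnit, ← h1]
    exact hZ'
  have hdet : Z'.det = Z.det * (L⁻¹ * Z' * L.transpose⁻¹).det := by
    conv_lhs => rw [h1]
    conv_rhs => rw [← hL.2.2]
    rw [Matrix.star_eq_conjTranspose, Matrix.conjTranspose_eq_transpose_of_trivial]
    simp only [Matrix.det_mul]
    ring
  have htr : (L⁻¹ * Z' * L.transpose⁻¹).trace = (Z⁻¹ * Z').trace := by
    rw [Matrix.trace_mul_comm, ← Matrix.mul_assoc, ← Matrix.mul_inv_rev, hL.2.2]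
  have h2 : (Z⁻¹ * (Z' - Z)).trace = (Z⁻¹ * Z').trace - n := by
    rw [Matrix.mul_sub, Matrix.nonsing_inv_mul _ hZ.det_pos.ne'.isUnit, Matrix.trace_sub,
      Matrix.trace_one, Fintype.card_fin]
  rw [hdet, Real.log_mul hZ.det_pos.ne' hW.det_pos.ne', h2, ← htr]
  linarith [hW.log_det_le_trace]

/-- With `X = L Lᵀ` the trace is that of the positive semidefinite `Lᵀ Z L`, which vanishes only for
`Z = 0`. -/
theorem Matrix.PosDef.trace_mul_pos {X Z : Matrix (Fin n) (Fin n) ℝ} (hX : X.PosDef)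
    (hZ : Z.PosSemidef) (hZ0 : Z ≠ 0) : 0 < (X * Z).trace := by
  obtain ⟨L, hL⟩ := hX.exists_isCholesky
  have h1 : (X * Z).trace = (star L * Z * L).trace := by
    rw [← hL.2.2, Matrix.star_eq_conjTranspose, Matrix.conjTranspose_eq_transpose_of_trivial,
      Matrix.mul_assoc, Matrix.trace_mul_comm]
  have h2 : (star L * Z * L).PosSemidef :=
    (Matrix.IsUnit.posSemidef_star_left_conjugate_iff hL.isUnit).2 hZ
  rw [h1]
  refine lt_of_le_of_ne h2.trace_nonneg fun h => hZ0 ?_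
  have h3 := h2.trace_eq_zero_iff.1 h.symm
  have h4 : IsUnit (star L) := hL.isUnit.star
  rw [hL.isUnit.mul_left_eq_zero, h4.mul_right_eq_zero] at h3
  exact h3

theorem Matrix.PosSemidef.posDef_of_det_pos {Z : Matrix (Fin n) (Fin n) ℝ} (hZ : Z.PosSemidef)
    (hd : 0 < Z.det) : Z.PosDef := by
  rw [hZ.1.posDef_iff_eigenvalues_pos]
  rw [hZ.1.det_eq_prod_eigenvalues] at hd
  intro i
  refine lt_of_le_of_ne (hZ.eigenvalues_nonneg i) fun h => hd.ne' ?_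
  exact Finset.prod_eq_zero (Finset.mem_univ i) (by rw [← h]; simp)

end MatrixFacts

/-! ### Topology of the space of symmetric matrices. -/

section SymMatFacts

variable {n : ℕ}

theorem symToMatrix_isHermitian (X : SymMat n) : (symToMatrix X).IsHermitian := by
  ext i j
  exact X.2 j i

theorem symToMatrix_add (X Y : SymMat n) :
    symToMatrix (X + Y) = symToMatrix X + symToMatrix Y := rfl

theorem symToMatrix_sub (X Y : SymMat n) :
    symToMatrix (X - Y) = symToMatrix X - symToMatrix Y := rfl

theorem symToMatrix_smul (c : ℝ) (X : SymMat n) : symToMatrix (c • X) = c • symToMatrix X := rfl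

theorem symToMatrix_injective : Function.Injective (symToMatrix (n := n)) := by
  intro X Y h
  ext ⟨i, j⟩
  exact congrFun (congrFun h i) j

theorem continuous_symToMatrix : Continuous (symToMatrix (n := n)) := by
  refine continuous_matrix fun i j => ?_
  change Continuous fun X : SymMat n => (X : EuclideanSpace ℝ (Fin n × Fin n)) (i, j)
  fun_prop

theorem inner_symMat (X Y : SymMat n) :
    inner ℝ X Y = (symToMatrix X * symToMatrix Y).trace := by
  rw [Submodule.coe_inner, PiLp.inner_apply, Fintype.sum_prod_type, Matrix.trace]
  refine Finset.sum_congr rfl fun i _ => ?_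
  rw [Matrix.diag_apply, Matrix.mul_apply]
  refine Finset.sum_congr rfl fun j _ => ?_
  rw [RCLike.inner_apply, mul_comm, Y.2 i j]
  rfl

/-- A real Hermitian matrix as an element of `SymMat n`. -/
def Matrix.IsHermitian.toSymMat {W : Matrix (Fin n) (Fin n) ℝ} (hW : W.IsHermitian) : SymMat n :=
  ⟨WithLp.toLp 2 fun q => W q.1 q.2, fun i j => (hW.apply i j).symm⟩

/-- The inverse of a symmetric matrix. -/
noncomputable def symInv (X : SymMat n) : SymMat n := (symToMatrix_isHermitian X).inv.toSymMat

theorem continuousAt_symInv {X : SymMat n} (hX : (symToMatrix X).det ≠ 0) :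
    ContinuousAt symInv X := by
  have h : ContinuousAt (fun Y : SymMat n => (symToMatrix Y)⁻¹) X := by
    refine ContinuousAt.comp (g := Inv.inv) ?_ continuous_symToMatrix.continuousAt
    exact continuousAt_matrix_inv _ (by
      rw [Ring.inverse_eq_inv']
      exact continuousAt_inv₀ hX)
  rw [Topology.IsInducing.subtypeVal.continuousAt_iff]
  refine (PiLp.continuous_toLp 2 _).continuousAt.comp ?_
  refine continuousAt_pi.2 fun q => ?_
  exact (continuous_apply_apply q.1 q.2).continuousAt.comp h

theorem isOpen_posDef : IsOpen {X : SymMat n | (symToMatrix X).PosDef} := by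
  have h : {X : SymMat n | (symToMatrix X).PosDef}
      = {X | ∀ v ∈ Metric.sphere (0 : Fin n → ℝ) 1, 0 < v ⬝ᵥ (symToMatrix X).mulVec v} := by
    ext X
    constructor
    · intro hX v hv
      exact hX.dotProduct_mulVec_pos (ne_zero_of_mem_unit_sphere (⟨v, hv⟩ : Metric.sphere _ _))
    · intro hX
      refine Matrix.PosDef.of_dotProduct_mulVec_pos (symToMatrix_isHermitian X) fun v hv => ?_
      have h1 := hX (‖v‖⁻¹ • v) (by simp [norm_smul, hv])
      rw [Matrix.mulVec_smul, smul_dotProduct, dotProduct_smul, smul_eq_mul, smul_eq_mul,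
        ← mul_assoc] at h1
      rw [star_trivial]
      exact pos_of_mul_pos_right h1 (by positivity)
  rw [h, isOpen_iff_eventually]
  intro X hX
  refine (isCompact_sphere (0 : Fin n → ℝ) 1).eventually_forall_of_forall_eventually fun v hv => ?_
  have hc : Continuous fun z : SymMat n × (Fin n → ℝ) =>
      z.2 ⬝ᵥ (symToMatrix z.1).mulVec z.2 :=
    continuous_snd.dotProduct
      ((continuous_symToMatrix.comp continuous_fst).matrix_mulVec continuous_snd)
  exact hc.continuousAt.eventually (lt_mem_nhds (hX v hv))

theorem isClosed_posSemidef : IsClosed {X : SymMat n | (symToMatrix X).PosSemidef} := by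
  have h : {X : SymMat n | (symToMatrix X).PosSemidef}
      = ⋂ v : Fin n → ℝ, {X | 0 ≤ v ⬝ᵥ (symToMatrix X).mulVec v} := by
    ext X
    simp only [Set.mem_iInter, Set.mem_ofPred_eq]
    exact ⟨fun hX v => hX.dotProduct_mulVec_nonneg v, fun hX =>
      Matrix.PosSemidef.of_dotProduct_mulVec_nonneg (symToMatrix_isHermitian X) hX⟩
  rw [h]
  exact isClosed_iInter fun v => isClosed_le continuous_const
    (continuous_const.dotProduct (continuous_symToMatrix.matrix_mulVec continuous_const))

/-- A positive definite `X` controls the norm of positive semidefinite matrices. -/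
theorem exists_norm_le_inner_of_posDef {X : SymMat n} (hX : (symToMatrix X).PosDef) :
    ∃ κ > 0, ∀ Z : SymMat n, (symToMatrix Z).PosSemidef → κ * ‖Z‖ ≤ inner ℝ X Z := by
  have hpos : ∀ Z : SymMat n, (symToMatrix Z).PosSemidef → Z ≠ 0 → 0 < inner ℝ X Z := by
    intro Z hZ hZ0
    rw [inner_symMat]
    exact hX.trace_mul_pos hZ fun h => hZ0 (symToMatrix_injective h)
  -- By homogeneity it suffices to minimize the positive functional `⟨X, ·⟩` over the compact unit
  -- slice of the semidefinite cone. The slice is empty when `n = 0`.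
  have hK : IsCompact (Metric.sphere (0 : SymMat n) 1 ∩ {Z | (symToMatrix Z).PosSemidef}) :=
    (isCompact_sphere 0 1).inter_right isClosed_posSemidef
  obtain ⟨κ, hκ, h⟩ : ∃ κ > 0, ∀ Z ∈ Metric.sphere (0 : SymMat n) 1 ∩
      {Z | (symToMatrix Z).PosSemidef}, κ ≤ inner ℝ X Z := by
    rcases Set.eq_empty_or_nonempty
      (Metric.sphere (0 : SymMat n) 1 ∩ {Z | (symToMatrix Z).PosSemidef}) with he | hne
    · exact ⟨1, one_pos, by simp [he]⟩
    · obtain ⟨Z, hZ, hmin⟩ := hK.exists_isMinOn hne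
        (f := fun Z => inner ℝ X Z) (by fun_prop)
      exact ⟨_, hpos Z hZ.2 (ne_zero_of_mem_unit_sphere (⟨Z, hZ.1⟩ : Metric.sphere _ _)), hmin⟩
  refine ⟨κ, hκ, fun Z hZ => ?_⟩
  rcases eq_or_ne Z 0 with rfl | hZ0
  · simp
  have h1 := h (‖Z‖⁻¹ • Z) ⟨by simp [norm_smul, hZ0], by
    rw [Set.mem_ofPred_eq, symToMatrix_smul]; exact hZ.smul (by positivity)⟩
  have h2 : inner ℝ X (‖Z‖⁻¹ • Z) = ‖Z‖⁻¹ * inner ℝ X Z :=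
    real_inner_smul_right (F := SymMat n) X Z ‖Z‖⁻¹
  rw [h2, inv_mul_eq_div, le_div_iff₀ (norm_pos_iff.2 hZ0)] at h1
  exact h1

end SymMatFacts

/-! ### Projected gradient steps for concave functions. -/

section ProjectedGradient

open Filter Topology

variable {E : Type*} [NormedAddCommGroup E] [InnerProductSpace ℝ E]

theorem IsProjOnto.inner_le_zero {S : Set E} (hS : Convex ℝ S) {x V : E} (h : IsProjOnto S x V)
    {w : E} (hw : w ∈ S) : inner ℝ (x - V) (w - V) ≤ 0 := by
  refine (norm_eq_iInf_iff_real_inner_le_zero hS h.1).1 ?_ w hw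
  have : Nonempty S := ⟨⟨V, h.1⟩⟩
  refine le_antisymm (le_ciInf fun v => ?_)
    (ciInf_le ⟨0, by rintro _ ⟨v, rfl⟩; exact norm_nonneg _⟩ (⟨V, h.1⟩ : S))
  rw [norm_sub_rev x V, norm_sub_rev x v]
  exact h.2 v v.2

theorem exists_isProjOnto [CompleteSpace E] {S : Set E} (hne : S.Nonempty) (hc : IsClosed S)
    (hS : Convex ℝ S) (x : E) : ∃ V, IsProjOnto S x V := by
  obtain ⟨V, hV, h⟩ := exists_norm_eq_iInf_of_complete_convex hne hc.isComplete hS x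
  refine ⟨V, hV, fun v hv => ?_⟩
  rw [norm_sub_rev V x, norm_sub_rev v x, h]
  exact ciInf_le ⟨0, by rintro _ ⟨v, rfl⟩; exact norm_nonneg _⟩ (⟨v, hv⟩ : S)

/-- The variational inequality of the projection, tested at `U` itself: the search direction is an
ascent direction. -/
theorem IsProjOnto.norm_sq_le {S : Set E} (hS : Convex ℝ S) {U G V : E} {α : ℝ} (hU : U ∈ S)
    (h : IsProjOnto S (U + α • G) V) : ‖V - U‖ ^ 2 ≤ α * inner ℝ G (V - U) := by
  have h1 := h.inner_le_zero hS hU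
  have h2 : U + α • G - V = α • G - (V - U) := by abel
  have h3 : U - V = -(V - U) := by abel
  rw [h2, h3, inner_neg_right, inner_sub_left, real_inner_smul_left,
    real_inner_self_eq_norm_sq] at h1
  linarith

/-- The variational inequality tested at `W`. If `V = U`, it becomes first-order optimality of `U`,
whatever the step size `α > 0`. -/
theorem IsProjOnto.inner_le {S : Set E} (hS : Convex ℝ S) {U G V W : E} {α : ℝ} (hW : W ∈ S)
    (h : IsProjOnto S (U + α • G) V) :
    α * inner ℝ G (W - U) ≤ α * inner ℝ G (V - U) + ‖V - U‖ * ‖W - U‖ := by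
  have h1 := h.inner_le_zero hS hW
  have h2 : U + α • G - V = α • G - (V - U) := by abel
  have h3 : W - V = (W - U) - (V - U) := by abel
  rw [h2, h3, inner_sub_left, inner_sub_right _ (W - U), inner_sub_right _ (W - U), real_inner_smul_left,
    real_inner_smul_left, real_inner_self_eq_norm_sq] at h1
  nlinarith [real_inner_le_norm (V - U) (W - U), sq_nonneg ‖V - U‖]

/-- A projected gradient step from a point that is not nearly optimal is not short. -/
theorem IsProjOnto.le_norm_mul {S : Set E} (hS : Convex ℝ S) {U G V W : E} {α a A η Γ R : ℝ}
    (hW : W ∈ S) (h : IsProjOnto S (U + α • G) V) (ha : 0 < a) (haα : a ≤ α) (hαA : α ≤ A)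
    (hη : 0 ≤ η) (hG : ‖G‖ ≤ Γ) (hR : ‖W - U‖ ≤ R) (hi : η ≤ inner ℝ G (W - U)) :
    a * η ≤ ‖V - U‖ * (A * Γ + R) := by
  have hα : 0 ≤ α := ha.le.trans haα
  calc a * η ≤ α * inner ℝ G (W - U) := mul_le_mul haα hi hη hα
    _ ≤ α * inner ℝ G (V - U) + ‖V - U‖ * ‖W - U‖ := h.inner_le hS hW
    _ ≤ A * (Γ * ‖V - U‖) + ‖V - U‖ * R := by
      have h1 : inner ℝ G (V - U) ≤ Γ * ‖V - U‖ := (real_inner_le_norm _ _).trans (by gcongr)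
      have h2 : 0 ≤ Γ * ‖V - U‖ := mul_nonneg ((norm_nonneg G).trans hG) (norm_nonneg _)
      exact add_le_add ((mul_le_mul_of_nonneg_left h1 hα).trans (mul_le_mul_of_nonneg_right hαA h2))
        (by gcongr)
    _ = _ := by ring

/-- The two supergradient inequalities squeeze the linearization error at `y` between `⟨G y - G x, y
- x⟩` and `0`. No explicit differentiation of `log det` is then needed. -/
theorem hasGradientAt_of_continuousAt_supergradient [CompleteSpace E] {g : E → ℝ} {G : E → E}
    {N : Set E} {x : E} (hN : N ∈ 𝓝 x) (hG : ContinuousAt G x)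
    (h : ∀ u ∈ N, ∀ v ∈ N, g v ≤ g u + inner ℝ (G u) (v - u)) : HasGradientAt g (G x) x := by
  rw [hasGradientAt_iff_isLittleO, Asymptotics.isLittleO_iff]
  intro c hc
  filter_upwards [hN, hG.eventually (Metric.ball_mem_nhds _ hc)] with y hy hyc
  have h1 := h x (mem_of_mem_nhds hN) y hy
  have h2 := h y hy x (mem_of_mem_nhds hN)
  have h3 : inner ℝ (G y) (x - y) = - inner ℝ (G y) (y - x) := by
    rw [← inner_neg_right, neg_sub]
  have h4 : |inner ℝ (G y - G x) (y - x)| ≤ c * ‖y - x‖ := by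
    refine (abs_real_inner_le_norm _ _).trans ?_
    gcongr
    exact (mem_ball_iff_norm.1 hyc).le
  rw [inner_sub_left, abs_le] at h4
  rw [Real.norm_eq_abs, abs_le]
  constructor <;> linarith

/-- Uniform validity of the sufficient increase condition for short steps. -/
theorem exists_sufficient_increase [CompleteSpace E] {g : E → ℝ} {N K : Set E} (hN : IsOpen N)
    (hK : IsCompact K) (hKN : K ⊆ N) (hG : ∀ u ∈ N, ContinuousAt (gradient g) u)
    (hg : ∀ u ∈ N, ∀ v ∈ N, g v ≤ g u + inner ℝ (gradient g u) (v - u))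
    {c A γ : ℝ} (hc : 0 < c) (hA : 0 < A) (hγ : γ < 1) :
    ∃ r > 0, ∀ u ∈ K, ∀ (D : E) (t : ℝ), c ≤ ‖D‖ → ‖D‖ ^ 2 ≤ A * inner ℝ (gradient g u) D →
      0 ≤ t → t * ‖D‖ < r →
      u + t • D ∈ N ∧ g u + γ * t * inner ℝ (gradient g u) D ≤ g (u + t • D) := by
  obtain ⟨r₁, hr₁, h₁⟩ := hK.exists_thickening_subset_open hN hKN
  -- With this tolerance on the gradient change, `c ≤ ‖D‖` and `‖D‖² ≤ A⟨∇g, D⟩` bound the loss of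
  -- slope by `(1 - γ)⟨∇g, D⟩`.
  have hε : 0 < (1 - γ) * c / A := by
    have : 0 < 1 - γ := by linarith
    positivity
  have h₂ := hK.uniformContinuousAt_of_continuousAt (gradient g) (fun u hu => hG u (hKN hu))
    (Metric.dist_mem_uniformity hε)
  obtain ⟨r₂, hr₂, h₂⟩ := Metric.mem_uniformity_dist.1 h₂
  refine ⟨min r₁ r₂, lt_min hr₁ hr₂, fun u hu D t hD hDA ht htr => ?_⟩
  have hdist : dist u (u + t • D) = t * ‖D‖ := by
    rw [dist_self_add_right, norm_smul, Real.norm_of_nonneg ht]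
  have hv : u + t • D ∈ N := h₁ (Metric.mem_thickening_iff.2 ⟨u, hu, by
    rw [dist_comm, hdist]; exact htr.trans_le (min_le_left _ _)⟩)
  refine ⟨hv, ?_⟩
  have h3 : dist (gradient g u) (gradient g (u + t • D)) < (1 - γ) * c / A :=
    h₂ (by rw [hdist]; exact htr.trans_le (min_le_right _ _)) hu
  -- Concavity read from the new point back to `u` bounds the gain below by `t⟨∇g(u + tD), D⟩`.
  have h4 := hg _ hv u (hKN hu)
  rw [sub_add_cancel_left, inner_neg_right, real_inner_smul_right] at h4
  have h5 : inner ℝ (gradient g u) D - inner ℝ (gradient g (u + t • D)) D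
      ≤ (1 - γ) * inner ℝ (gradient g u) D := by
    rw [← inner_sub_left]
    refine (real_inner_le_norm _ _).trans ?_
    rw [← dist_eq_norm]
    calc dist (gradient g u) (gradient g (u + t • D)) * ‖D‖
        ≤ ((1 - γ) * c / A) * ‖D‖ := by gcongr
      _ ≤ ((1 - γ) * ‖D‖ / A) * ‖D‖ := by
          have : 0 ≤ 1 - γ := by linarith
          gcongr
      _ = (1 - γ) * (‖D‖ ^ 2 / A) := by ring
      _ ≤ (1 - γ) * inner ℝ (gradient g u) D := by
          have : 0 ≤ 1 - γ := by linarith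
          gcongr
          rw [div_le_iff₀ hA, mul_comm]
          exact hDA
  nlinarith [mul_le_mul_of_nonneg_left h5 ht]

/-- If each term exceeds the minimum of the `M` preceding ones by a fixed amount or is at least
`B`, then the terms are eventually at least `B`. -/
theorem eventually_le_of_window {a : ℕ → ℝ} {M : ℕ} {b₀ c B : ℝ} (hc : 0 < c)
    (h₀ : ∀ k, b₀ ≤ a k)
    (h : ∀ k b, (∀ l ∈ Finset.Icc (k + 1 - M) k, b ≤ a l) → min (b + c) B ≤ a (k + 1)) :
    ∀ᶠ k in atTop, B ≤ a k := by
  have key : ∀ q : ℕ, ∃ K, ∀ k ≥ K, min (b₀ + q * c) B ≤ a k := by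
    intro q
    induction q with
    | zero => exact ⟨0, fun k _ => (min_le_left _ _).trans (by simpa using h₀ k)⟩
    | succ q ih =>
      obtain ⟨K, hK⟩ := ih
      -- The shift by `M` puts the whole window preceding index `k` beyond `K`.
      refine ⟨K + M + 1, fun k hk => ?_⟩
      obtain ⟨k, rfl⟩ : ∃ k', k = k' + 1 := ⟨k - 1, by omega⟩
      refine le_trans ?_ (h k (min (b₀ + q * c) B) fun l hl => hK l ?_)
      · push_cast
        rw [← min_add_add_right]
        exact le_min (le_min ((min_le_left _ _).trans (by linarith))
          ((min_le_right _ _).trans (by linarith))) (min_le_right _ _)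
      · rw [Finset.mem_Icc] at hl
        omega
  obtain ⟨q, hq⟩ := exists_nat_ge ((B - b₀) / c)
  obtain ⟨K, hK⟩ := key q
  filter_upwards [eventually_ge_atTop K] with k hk
  refine le_trans (le_min ?_ le_rfl) (hK k hk)
  rw [div_le_iff₀ hc] at hq
  linarith

end ProjectedGradient

/-! ### Balls of the conjugate norms. -/

theorem ENNReal.one_le_conjExponent (p : ℝ≥0∞) : 1 ≤ ENNReal.conjExponent p := by
  rw [ENNReal.conjExponent]
  exact le_self_add

section LpBall

variable {d : ℕ} (q : ℝ≥0∞)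

/-- The identity from Euclidean space to `ℓ_q`. -/
noncomputable def euclideanToLp [Fact (1 ≤ q)] :
    EuclideanSpace ℝ (Fin d) ≃L[ℝ] PiLp q fun _ : Fin d => ℝ :=
  (PiLp.continuousLinearEquiv 2 ℝ fun _ : Fin d => ℝ).trans
    (PiLp.continuousLinearEquiv q ℝ fun _ : Fin d => ℝ).symm

theorem setOf_lpNormVec_le_eq [Fact (1 ≤ q)] (r : ℝ) :
    {z : EuclideanSpace ℝ (Fin d) | lpNormVec q z ≤ r}
      = euclideanToLp q ⁻¹' Metric.closedBall 0 r := by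
  ext z
  rw [Set.mem_preimage, mem_closedBall_zero_iff]
  rfl

theorem isCompact_setOf_lpNormVec_le [Fact (1 ≤ q)] (r : ℝ) :
    IsCompact {z : EuclideanSpace ℝ (Fin d) | lpNormVec q z ≤ r} := by
  have : ProperSpace (PiLp q fun _ : Fin d => ℝ) := FiniteDimensional.proper_real _
  rw [setOf_lpNormVec_le_eq]
  exact (euclideanToLp q).toHomeomorph.isCompact_preimage.2 (isCompact_closedBall _ _)

theorem convex_setOf_lpNormVec_le [Fact (1 ≤ q)] (r : ℝ) :
    Convex ℝ {z : EuclideanSpace ℝ (Fin d) | lpNormVec q z ≤ r} := by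
  rw [setOf_lpNormVec_le_eq]
  exact (convex_closedBall _ _).linear_preimage (euclideanToLp q).toLinearEquiv.toLinearMap

end LpBall

/-! ### The dual problem: feasible set, gradient and compact superlevel sets. -/

namespace LogDetSDP

variable (P : LogDetSDP)

set_option synthInstance.maxHeartbeats 200000 in
noncomputable instance instInnerProductSpaceDualSpace : InnerProductSpace ℝ P.DualSpace :=
  inferInstance

instance instFiniteDimensionalDualSpace : FiniteDimensional ℝ P.DualSpace := inferInstance

instance instCompleteSpaceDualSpace : CompleteSpace P.DualSpace := inferInstance

theorem calS_eq_image (h : Fin P.H) : P.calS h = LinearMap.adjoint (P.Q h) ''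
    {z | lpNormVec (ENNReal.conjExponent (P.p h)) z ≤ P.lam h} := by
  ext S
  exact ⟨fun ⟨z, hz, hS⟩ => ⟨z, hz, hS.symm⟩, fun ⟨z, hz, hS⟩ => ⟨z, hz, hS.symm⟩⟩

theorem isCompact_calS (h : Fin P.H) : IsCompact (P.calS h) := by
  have : Fact (1 ≤ ENNReal.conjExponent (P.p h)) := ⟨ENNReal.one_le_conjExponent _⟩
  rw [calS_eq_image]
  exact (isCompact_setOf_lpNormVec_le _ _).image (LinearMap.continuous_of_finiteDimensional _)

theorem convex_calS (h : Fin P.H) : Convex ℝ (P.calS h) := by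
  have : Fact (1 ≤ ENNReal.conjExponent (P.p h)) := ⟨ENNReal.one_le_conjExponent _⟩
  rw [calS_eq_image]
  exact (convex_setOf_lpNormVec_le _ _).linear_image _

theorem continuous_snd_apply (h : Fin P.H) : Continuous fun U : P.DualSpace => U.snd h := by
  fun_prop

theorem isClosed_calM : IsClosed P.calM := by
  have : P.calM = ⋂ h, (fun U : P.DualSpace => U.snd h) ⁻¹' P.calS h := by
    ext U; simp [calM]
  rw [this]
  exact isClosed_iInter fun h => (P.isCompact_calS h).isClosed.preimage (P.continuous_snd_apply h)

theorem convex_calM : Convex ℝ P.calM := by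
  intro U hU V hV a b ha hb hab h
  exact P.convex_calS h (hU h) (hV h) ha hb hab

/-- `𝓑` as a linear map. -/
noncomputable def calBLin : P.DualSpace →ₗ[ℝ] SymMat P.n where
  toFun := P.calB
  map_add' U V := by
    simp only [calB, WithLp.add_fst, WithLp.add_snd, PiLp.add_apply, map_add,
      Finset.sum_add_distrib]
    abel
  map_smul' c U := by
    simp only [calB, WithLp.smul_fst, WithLp.smul_snd, PiLp.smul_apply, map_smul,
      ← Finset.smul_sum, RingHom.id_apply, smul_add, smul_neg]

theorem calBLin_apply (U : P.DualSpace) : P.calBLin U = P.calB U := rfl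

theorem calB_sub (U V : P.DualSpace) : P.calB (U - V) = P.calB U - P.calB V :=
  map_sub P.calBLin U V

theorem calB_add_smul (U D : P.DualSpace) (t : ℝ) :
    P.calB (U + t • D) = P.calB U + t • P.calB D := by
  rw [← calBLin_apply, map_add, map_smul]
  rfl

theorem continuous_calB : Continuous P.calB := LinearMap.continuous_of_finiteDimensional P.calBLin

theorem isOpen_calN : IsOpen P.calN :=
  isOpen_posDef.preimage (continuous_const.add P.continuous_calB)

theorem add_smul_sub_mem_calM {U V : P.DualSpace} {t : ℝ} (hU : U ∈ P.calM) (hV : V ∈ P.calM)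
    (h0 : 0 ≤ t) (h1 : t ≤ 1) : U + t • (V - U) ∈ P.calM :=
  P.convex_calM.add_smul_sub_mem hU hV ⟨h0, h1⟩

/-- The gradient of the dual objective on `calN`. -/
noncomputable def gradG (U : P.DualSpace) : P.DualSpace :=
  WithLp.toLp 2 (P.b, 0) + P.mu • LinearMap.adjoint P.calBLin (symInv (P.C + P.calB U))

set_option synthInstance.maxHeartbeats 200000 in
theorem inner_gradG (U D : P.DualSpace) : inner ℝ (P.gradG U) D = inner ℝ P.b D.fst
    + P.mu * ((symToMatrix (P.C + P.calB U))⁻¹ * symToMatrix (P.calB D)).trace := by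
  have h1 : inner ℝ (WithLp.toLp 2 (P.b, 0) : P.DualSpace) D = inner ℝ P.b D.fst := by
    refine (WithLp.prod_inner_apply _ _).trans ?_
    simp
  have h2 := real_inner_smul_left (F := P.DualSpace)
    (LinearMap.adjoint P.calBLin (symInv (P.C + P.calB U))) D P.mu
  rw [gradG, inner_add_left, h1, h2, LinearMap.adjoint_inner_left, inner_symMat]
  rfl

theorem g_le_add_inner_gradG {U V : P.DualSpace} (hU : U ∈ P.calN) (hV : V ∈ P.calN) :
    P.g V ≤ P.g U + inner ℝ (P.gradG U) (V - U) := by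
  have h := Matrix.PosDef.log_det_le hU hV
  have h1 : symToMatrix (P.C + P.calB V) - symToMatrix (P.C + P.calB U)
      = symToMatrix (P.calB (V - U)) := by
    rw [← symToMatrix_sub, calB_sub, add_sub_add_left_eq_sub]
  have h2 : inner ℝ P.b (V - U).fst = inner ℝ P.b V.fst - inner ℝ P.b U.fst := by
    rw [WithLp.sub_fst, inner_sub_right]
  rw [h1] at h
  rw [inner_gradG, h2, g, g]
  nlinarith [mul_le_mul_of_nonneg_left h P.mu_pos.le]

theorem continuousAt_gradG {U : P.DualSpace} (hU : U ∈ P.calN) : ContinuousAt P.gradG U := by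
  refine continuousAt_const.add (ContinuousAt.const_smul ?_ P.mu)
  refine ContinuousAt.comp (g := LinearMap.adjoint P.calBLin)
    (LinearMap.continuous_of_finiteDimensional _).continuousAt ?_
  refine ContinuousAt.comp (f := fun U => P.C + P.calB U)
    (continuousAt_symInv (Matrix.PosDef.det_pos hU).ne') ?_
  exact (continuous_const.add P.continuous_calB).continuousAt

theorem hasGradientAt_g {U : P.DualSpace} (hU : U ∈ P.calN) :
    HasGradientAt P.g (P.gradG U) U :=
  hasGradientAt_of_continuousAt_supergradient (P.isOpen_calN.mem_nhds hU) (P.continuousAt_gradG hU)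
    fun _ hu _ hv => P.g_le_add_inner_gradG hu hv

theorem gradient_g {U : P.DualSpace} (hU : U ∈ P.calN) : gradient P.g U = P.gradG U :=
  (P.hasGradientAt_g hU).gradient

theorem continuousAt_gradient_g {U : P.DualSpace} (hU : U ∈ P.calN) :
    ContinuousAt (gradient P.g) U := by
  refine (P.continuousAt_gradG hU).congr ?_
  filter_upwards [P.isOpen_calN.mem_nhds hU] with V hV using (P.gradient_g hV).symm

theorem continuousAt_g {U : P.DualSpace} (hU : U ∈ P.calN) : ContinuousAt P.g U :=
  (P.hasGradientAt_g hU).continuousAt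

theorem g_le_add_inner_gradient {U V : P.DualSpace} (hU : U ∈ P.calN) (hV : V ∈ P.calN) :
    P.g V ≤ P.g U + inner ℝ (gradient P.g U) (V - U) := by
  rw [P.gradient_g hU]
  exact P.g_le_add_inner_gradG hU hV

/-- All conditions on the right are closed: the lower bound on the determinant excludes singular
slacks, so semidefiniteness can replace definiteness. -/
theorem superlevel_eq (c : ℝ) : {U | U ∈ P.dualFeasible ∧ c ≤ P.g U}
    = {U | U ∈ P.calM ∧ (symToMatrix (P.C + P.calB U)).PosSemidef ∧
      Real.exp ((c - inner ℝ P.b U.fst - P.n * P.mu + P.n * P.mu * Real.log P.mu) / P.mu)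
        ≤ (symToMatrix (P.C + P.calB U)).det} := by
  ext U
  have key : (symToMatrix (P.C + P.calB U)).PosDef → (c ≤ P.g U ↔
      Real.exp ((c - inner ℝ P.b U.fst - P.n * P.mu + P.n * P.mu * Real.log P.mu) / P.mu)
        ≤ (symToMatrix (P.C + P.calB U)).det) := by
    intro h
    rw [← Real.le_log_iff_exp_le h.det_pos, div_le_iff₀ P.mu_pos, g]
    constructor <;> intro h <;> linarith
  constructor
  · rintro ⟨⟨hM, hN⟩, hc⟩
    exact ⟨hM, hN.posSemidef, (key hN).1 hc⟩
  · rintro ⟨hM, hN, hc⟩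
    have hN' := hN.posDef_of_det_pos ((Real.exp_pos _).trans_le hc)
    exact ⟨⟨hM, hN'⟩, (key hN').2 hc⟩

theorem isClosed_superlevel (c : ℝ) : IsClosed {U | U ∈ P.dualFeasible ∧ c ≤ P.g U} := by
  rw [superlevel_eq]
  have hZ : Continuous fun U => P.C + P.calB U := continuous_const.add P.continuous_calB
  refine P.isClosed_calM.inter (IsClosed.inter (isClosed_posSemidef.preimage hZ)
    (isClosed_le (f := fun U : P.DualSpace => Real.exp ((c - inner ℝ P.b U.fst - P.n * P.mu
      + P.n * P.mu * Real.log P.mu) / P.mu)) ?_ ?_))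
  · refine Real.continuous_exp.comp (Continuous.div_const ?_ _)
    fun_prop
  · exact (continuous_symToMatrix.comp hZ).matrix_det

theorem exists_norm_sum_snd_le : ∃ R, ∀ U ∈ P.calM, ‖∑ h, U.snd h‖ ≤ R := by
  choose R hR using fun h => (P.isCompact_calS h).isBounded.exists_norm_le
  exact ⟨∑ h, R h, fun U hU => norm_sum_le_of_le _ fun h _ => hR h _ (hU h)⟩

/-- Since `b = A X`, the term `bᵀ y` equals `⟨X, C + ∑ S_h⟩ - ⟨X, Z⟩` with `Z` the slack. The linear
term `-⟨X, Z⟩` dominates `μ log det Z`, and `⟨X, Z⟩` controls `‖Z‖`. -/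
theorem exists_norm_slack_le (hprimal : ∃ X : SymMat P.n, P.PrimalStrictlyFeasible X) (c : ℝ) :
    ∃ R, ∀ U ∈ P.dualFeasible, c ≤ P.g U → ‖P.C + P.calB U‖ ≤ R := by
  obtain ⟨X, hXb, hX⟩ := hprimal
  obtain ⟨κ, hκ, hκX⟩ := exists_norm_le_inner_of_posDef hX
  obtain ⟨R, hR⟩ := P.exists_norm_sum_snd_le
  have hμ := P.mu_pos
  -- The tangent point `Y` is chosen so that `μ Y⁻¹ = X / 2`: the tangent plane of `μ log det` then
  -- uses up only half of `⟨X, Z⟩`.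
  set Y : Matrix (Fin P.n) (Fin P.n) ℝ := (2 * P.mu) • (symToMatrix X)⁻¹ with hY
  have hYpos : Y.PosDef := hX.inv.smul (by positivity)
  have hYinv : Y⁻¹ = (2 * P.mu)⁻¹ • symToMatrix X := by
    have h2 : (2 * P.mu) ≠ 0 := by positivity
    have := hX.isUnit
    rw [Matrix.isUnit_iff_isUnit_det] at this
    refine Matrix.inv_eq_left_inv ?_
    rw [hY, Matrix.smul_mul, Matrix.mul_smul, smul_smul, inv_mul_cancel₀ h2, one_smul,
      Matrix.mul_nonsing_inv _ this]
  set B := inner ℝ X P.C + ‖X‖ * R + P.mu * Real.log Y.det - P.mu * (Y⁻¹ * Y).trace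
    + P.n * P.mu - P.n * P.mu * Real.log P.mu - c with hB
  refine ⟨2 * B / κ, fun U hU hc => ?_⟩
  set Z := P.C + P.calB U with hZ
  have h1 : inner ℝ P.b U.fst = inner ℝ X P.C + inner ℝ X (∑ h, U.snd h) - inner ℝ X Z := by
    rw [← hXb, ← LinearMap.adjoint_inner_right, ← inner_add_right, ← inner_sub_right, hZ, calB]
    congr 1
    abel
  have h2 : inner ℝ X (∑ h, U.snd h) ≤ ‖X‖ * R :=
    (real_inner_le_norm _ _).trans (by gcongr; exact hR U hU.1)
  have h3 := hYpos.log_det_le hU.2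
  have h4 : (Y⁻¹ * (symToMatrix Z - Y)).trace = inner ℝ X Z / (2 * P.mu) - (Y⁻¹ * Y).trace := by
    rw [Matrix.mul_sub, Matrix.trace_sub, inner_symMat, hYinv, Matrix.smul_mul, Matrix.trace_smul,
      smul_eq_mul, inv_mul_eq_div]
  rw [h4] at h3
  have h5 := mul_le_mul_of_nonneg_left h3 hμ.le
  have h6 : P.mu * (Real.log Y.det + (inner ℝ X Z / (2 * P.mu) - (Y⁻¹ * Y).trace))
      = P.mu * Real.log Y.det + inner ℝ X Z / 2 - P.mu * (Y⁻¹ * Y).trace := by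
    field_simp
    ring
  rw [h6] at h5
  have h7 := hκX Z hU.2.posSemidef
  rw [le_div_iff₀ hκ]
  rw [g, h1] at hc
  linarith

theorem isCompact_superlevel (hA : Function.Surjective P.A)
    (hprimal : ∃ X : SymMat P.n, P.PrimalStrictlyFeasible X) (c : ℝ) :
    IsCompact {U | U ∈ P.dualFeasible ∧ c ≤ P.g U} := by
  obtain ⟨R₁, h₁⟩ := P.exists_norm_slack_le hprimal c
  obtain ⟨R₂, h₂⟩ := P.exists_norm_sum_snd_le
  -- Surjectivity of `A` makes `Aᵀ` injective, hence bounded below, so a bound on `Aᵀ y = C + ∑ S_h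
  -- - Z` bounds `y`.
  have hinj : (LinearMap.adjoint P.A).ker = ⊥ := by
    rw [LinearMap.ker_eq_bot']
    intro y hy
    obtain ⟨X, rfl⟩ := hA y
    rw [← inner_self_eq_zero (𝕜 := ℝ), ← LinearMap.adjoint_inner_right, hy, inner_zero_right]
  obtain ⟨K, -, hK⟩ := (LinearMap.adjoint P.A).exists_antilipschitzWith hinj
  refine Metric.isCompact_of_isClosed_isBounded (P.isClosed_superlevel c) ?_
  have hcomp : IsCompact ((WithLp.prodContinuousLinearEquiv 2 ℝ (EuclideanSpace ℝ (Fin P.m))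
      (PiLp 2 fun _ : Fin P.H => SymMat P.n)).symm ''
      (Metric.closedBall 0 (K * (‖P.C‖ + R₂ + R₁)) ×ˢ ((PiLp.continuousLinearEquiv 2 ℝ
        fun _ : Fin P.H => SymMat P.n).symm '' Set.univ.pi fun h => P.calS h))) :=
    ((isCompact_closedBall _ _).prod ((isCompact_univ_pi P.isCompact_calS).image
      (ContinuousLinearEquiv.continuous _))).image (ContinuousLinearEquiv.continuous _)
  refine hcomp.isBounded.subset ?_
  rintro U ⟨hU, hc⟩
  refine ⟨(U.fst, U.snd), ⟨?_, ⟨fun h => U.snd h, fun h _ => hU.1 h, rfl⟩⟩, rfl⟩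
  have h3 := hK.le_mul_dist U.fst 0
  rw [map_zero, dist_zero_right, dist_zero_right] at h3
  have h4 : LinearMap.adjoint P.A U.fst = P.C + ∑ h, U.snd h - (P.C + P.calB U) := by
    rw [calB]; abel
  rw [mem_closedBall_zero_iff]
  refine h3.trans ?_
  gcongr
  rw [h4]
  refine (norm_sub_le _ _).trans (add_le_add ((norm_add_le _ _).trans ?_) (h₁ U hU hc))
  gcongr
  exact h₂ U hU.1

end LogDetSDP

/-! ### The algorithm: step lengths, existence of runs and uniform progress. -/

theorem DSPGParams.αmax_pos (par : DSPGParams) : 0 < par.αmax :=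
  par.αmin_pos.trans par.αmin_lt_αmax

/-- A sequence in which each term is determined by the preceding ones. -/
theorem exists_seq_of_history {X : Type*} (x₀ : X) (next : ℕ → (ℕ → X) → X) :
    ∃ u : ℕ → X, u 0 = x₀ ∧
      ∀ k, ∃ w : ℕ → X, (∀ i ≤ k, w i = u i) ∧ u (k + 1) = next k w := by
  -- `F k` is a full sequence whose entries up to `k` are final; the result is its diagonal, and `F
  -- k` serves as the history `w`.
  let F : ℕ → ℕ → X := fun k => Nat.rec (fun _ => x₀)
    (fun k f => Function.update f (k + 1) (next k f)) k
  have hF : ∀ k, F (k + 1) = Function.update (F k) (k + 1) (next k (F k)) := fun _ => rfl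
  have hstab : ∀ k i, i ≤ k → F k i = F i i := by
    intro k
    induction k with
    | zero => intro i hi; rw [Nat.le_zero.1 hi]
    | succ k ih =>
      intro i hi
      rcases Nat.lt_or_ge k i with h | h
      · rw [le_antisymm hi h]
      · rw [hF, Function.update_of_ne (by omega), ih i h]
  refine ⟨fun k => F k k, rfl, fun k => ⟨F k, hstab k, ?_⟩⟩
  simp only [hF, Function.update_self]

namespace LogDetSDP

open Filter Topology

variable (P : LogDetSDP) (par : DSPGParams)

section StepAdjustment

theorem nuOf_pos (θ : ℝ) : 0 < nuOf par θ := by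
  unfold nuOf
  split_ifs with h
  · exact one_pos
  · exact lt_min one_pos (div_pos_of_neg_of_neg (neg_neg_of_pos par.τ_pos) (not_le.1 h))

theorem nuOf_le_one (θ : ℝ) : nuOf par θ ≤ 1 := by
  unfold nuOf
  split_ifs with h
  · exact le_rfl
  · exact min_le_left _ _

theorem one_add_mul_pos_of_le_nuOf {θ t : ℝ} (h0 : 0 ≤ t) (ht : t ≤ nuOf par θ) :
    0 < 1 + t * θ := by
  unfold nuOf at ht
  split_ifs at ht with h
  · positivity
  · have h1 := ht.trans (min_le_right _ _)
    rw [le_div_iff_of_neg (not_le.1 h)] at h1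
    linarith [par.τ_lt_one]

/-- For `θ < 0` the hypothesis says `s < -1/θ`, so the adjustment costs at most a factor `τ` against
any step known to stay in `𝓝`. -/
theorem min_le_nuOf {θ s : ℝ} (h : 0 < 1 + s * θ) :
    min 1 (par.τ * s) ≤ nuOf par θ := by
  unfold nuOf
  split_ifs with hθ
  · exact min_le_left _ _
  · refine min_le_min le_rfl ?_
    rw [le_div_iff_of_neg (not_le.1 hθ)]
    nlinarith [par.τ_pos]

end StepAdjustment

theorem add_smul_mem_calN_iff {U D : P.DualSpace} {L : Matrix (Fin P.n) (Fin P.n) ℝ} {θ t : ℝ}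
    (hL : IsCholesky (symToMatrix (P.C + P.calB U)) L)
    (hθ : IsMinEigenvalue (L⁻¹ * symToMatrix (P.calB D) * (L.transpose)⁻¹) θ) (ht : 0 ≤ t) :
    U + t • D ∈ P.calN ↔ 0 < 1 + t * θ := by
  rw [← hL.posDef_add_smul_iff (symToMatrix_isHermitian _) hθ ht]
  change (symToMatrix (P.C + P.calB (U + t • D))).PosDef ↔ _
  rw [calB_add_smul, ← add_assoc, symToMatrix_add, symToMatrix_smul]

theorem nextAlpha_mem_Icc (U U' : P.DualSpace) :
    P.nextAlpha par U U' ∈ Set.Icc par.αmin par.αmax := by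
  unfold nextAlpha
  dsimp only
  split_ifs
  · exact ⟨par.αmin_lt_αmax.le, le_rfl⟩
  · exact ⟨le_min par.αmin_lt_αmax.le (le_max_left _ _), min_le_left _ _⟩

variable {P par}

theorem windowMin_le (U : ℕ → P.DualSpace) (k : ℕ) : P.windowMin par U k ≤ P.g (U k) :=
  Finset.inf'_le _ (Finset.mem_Icc.2 ⟨by have := par.M_pos; omega, le_rfl⟩)

theorem le_windowMin {U : ℕ → P.DualSpace} {k : ℕ} {b : ℝ}
    (h : ∀ l ∈ Finset.Icc (k + 1 - par.M) k, b ≤ P.g (U l)) : b ≤ P.windowMin par U k :=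
  Finset.le_inf' _ _ h

theorem windowMin_congr {U U' : ℕ → P.DualSpace} {k : ℕ} (h : ∀ i ≤ k, U i = U' i) :
    P.windowMin par U k = P.windowMin par U' k :=
  Finset.inf'_congr _ rfl fun l hl => by rw [h l (Finset.mem_Icc.1 hl).2]

/-- A stationary point of the dual problem is optimal. -/
theorem g_le_of_isProjOnto_self {U W : P.DualSpace} {α : ℝ} (hα : 0 < α) (hU : U ∈ P.dualFeasible)
    (h : IsProjOnto P.calM (U + α • gradient P.g U) U) (hW : W ∈ P.dualFeasible) :
    P.g W ≤ P.g U := by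
  have h1 := h.inner_le P.convex_calM hW.1
  rw [sub_self, inner_zero_right, norm_zero, mul_zero, zero_mul, add_zero] at h1
  linarith [P.g_le_add_inner_gradient hU.2 hW.2, nonpos_of_mul_nonpos_right h1 hα]

/-- Collects what convergence needs from one iteration. The last clause bounds the accepted step
below, given a radius `r` within which every step along the direction stays in `𝓝` and gives
sufficient increase. -/
theorem IsStep.exists_step_size {U : ℕ → P.DualSpace} {α : ℕ → ℝ} {k : ℕ}
    (h : P.IsStep par U α k) (hU : U k ∈ P.dualFeasible) :
    ∃ (V : P.DualSpace) (t : ℝ), IsProjOnto P.calM (U k + α k • gradient P.g (U k)) V ∧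
      0 < t ∧ t ≤ 1 ∧ U (k + 1) = U k + t • (V - U k) ∧ U (k + 1) ∈ P.dualFeasible ∧
      P.windowMin par U k + par.γ * (t * inner ℝ (gradient P.g (U k)) (V - U k))
        ≤ P.g (U (k + 1)) ∧
      ∀ r > 0, 0 < ‖V - U k‖ → (∀ s : ℝ, 0 ≤ s → s * ‖V - U k‖ < r →
        U k + s • (V - U k) ∈ P.calN ∧ P.g (U k) +
          par.γ * s * inner ℝ (gradient P.g (U k)) (V - U k) ≤ P.g (U k + s • (V - U k))) →
        min 1 (min par.τ par.β * (r / (2 * ‖V - U k‖))) ≤ t := by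
  obtain ⟨V, D, L, θ, ν, j, hV, rfl, hL, hθ, rfl, hacc, hrej, hnext, -⟩ := h
  have hν := nuOf_pos par θ
  have hν1 := nuOf_le_one par θ
  have hβ := par.β_pos
  have hβj : par.β ^ j ≤ 1 := pow_le_one₀ hβ.le par.β_lt_one.le
  have ht0 : 0 < par.β ^ j * nuOf par θ := by positivity
  have htν : par.β ^ j * nuOf par θ ≤ nuOf par θ := mul_le_of_le_one_left hν.le hβj
  refine ⟨V, par.β ^ j * nuOf par θ, hV, ht0, htν.trans hν1, hnext, ?_, ?_, ?_⟩
  · rw [hnext]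
    exact ⟨P.add_smul_sub_mem_calM hU.1 hV.1 ht0.le (htν.trans hν1),
      (P.add_smul_mem_calN_iff hL hθ ht0.le).2 (one_add_mul_pos_of_le_nuOf par ht0.le htν)⟩
  · rw [hnext]
    refine le_trans (le_of_eq ?_) hacc
    ring
  · intro r hr hD hs
    -- Half the radius is used because the assumption on `r` covers only strictly shorter steps.
    have hhalf : r / (2 * ‖V - U k‖) * ‖V - U k‖ < r := by
      have : r / (2 * ‖V - U k‖) * ‖V - U k‖ = r / 2 := by field_simp
      rw [this]
      exact half_lt_self hr
    have hs0 : 0 < r / (2 * ‖V - U k‖) := by positivity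
    -- Without backtracking the step is `ν`, bounded below through feasibility. Otherwise the
    -- preceding trial was rejected, so its length was at least `r`, and the accepted one is `β`
    -- times it.
    rcases j with _ | j
    · rw [pow_zero, one_mul]
      refine le_trans (min_le_min le_rfl ?_) (min_le_nuOf par
        ((P.add_smul_mem_calN_iff hL hθ hs0.le).1 (hs _ hs0.le hhalf).1))
      gcongr
      exact min_le_left _ _
    · refine (min_le_right _ _).trans ?_
      have hj0 : 0 < par.β ^ j * nuOf par θ := by positivity
      have h1 : r ≤ par.β ^ j * nuOf par θ * ‖V - U k‖ := by
        by_contra! hlt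
        refine hrej j (Nat.lt_succ_self j) (le_trans ?_ (hs _ hj0.le hlt).2)
        rw [← mul_assoc par.γ]
        gcongr
        exact windowMin_le U k
      have h2 : r / (2 * ‖V - U k‖) ≤ par.β ^ j * nuOf par θ := by
        rw [div_le_iff₀ (by positivity)]
        nlinarith [mul_pos hj0 hD]
      calc min par.τ par.β * (r / (2 * ‖V - U k‖))
          ≤ par.β * (par.β ^ j * nuOf par θ) :=
            mul_le_mul (min_le_right _ _) h2 hs0.le hβ.le
        _ = _ := by ring

/-- The predicted gain is nonnegative, so a lower bound `g(U⁰)` on the window passes to the next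
iterate. All iterates thus stay in one compact superlevel set. -/
theorem mem_of_isStep {U : ℕ → P.DualSpace} {α : ℕ → ℝ} (hU0 : U 0 ∈ P.dualFeasible)
    (hα0 : α 0 ∈ Set.Icc par.αmin par.αmax) (k : ℕ) (h : ∀ i < k, P.IsStep par U α i) :
    U k ∈ P.dualFeasible ∧ α k ∈ Set.Icc par.αmin par.αmax ∧ P.g (U 0) ≤ P.g (U k) := by
  induction k using Nat.strong_induction_on with
  | _ k ih =>
    rcases k with _ | k
    · exact ⟨hU0, hα0, le_rfl⟩
    have hk := ih k (Nat.lt_succ_self k) fun i hi => h i (by omega)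
    have hstep := h k (Nat.lt_succ_self k)
    obtain ⟨V, t, hV, ht0, -, -, hF, hinc, -⟩ := hstep.exists_step_size hk.1
    refine ⟨hF, ?_, ?_⟩
    · obtain ⟨_, _, _, _, _, _, _, _, _, _, _, _, _, _, hα⟩ := hstep
      rw [hα]
      exact P.nextAlpha_mem_Icc par _ _
    · have h1 : P.g (U 0) ≤ P.windowMin par U k := le_windowMin fun l hl => by
        have := (Finset.mem_Icc.1 hl).2
        exact (ih l (by omega) fun i hi => h i (by omega)).2.2
      have h2 : 0 ≤ inner ℝ (gradient P.g (U k)) (V - U k) :=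
        nonneg_of_mul_nonneg_right ((sq_nonneg _).trans (hV.norm_sq_le P.convex_calM hk.1.1))
          (par.αmin_pos.trans_le hk.2.1.1)
      have := par.γ_pos
      exact h1.trans ((le_add_of_nonneg_right (by positivity)).trans hinc)

/-- For `n = 0` no least eigenvalue exists and no step can be made, but the dual space is then a
point and the stopping test succeeds at once. -/
theorem subsingleton_dualSpace (hA : Function.Surjective P.A) (hn : P.n = 0) :
    Subsingleton P.DualSpace := by
  have : IsEmpty (Fin P.n) := by rw [hn]; infer_instance
  have hS : Subsingleton (SymMat P.n) :=
    ⟨fun X Y => symToMatrix_injective (Subsingleton.elim _ _)⟩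
  have hy : Subsingleton (EuclideanSpace ℝ (Fin P.m)) := hA.subsingleton
  refine ⟨fun U V => ?_⟩
  have h1 : U.fst = V.fst := Subsingleton.elim _ _
  have h2 : U.snd = V.snd := PiLp.ext fun h => Subsingleton.elim (U.snd h) (V.snd h)
  exact WithLp.ofLp_injective 2 (Prod.ext h1 h2)

theorem neZero_of_continues (hA : Function.Surjective P.A) {U : P.DualSpace}
    (h : P.Continues 0 U) : NeZero P.n := by
  refine ⟨fun hn => ?_⟩
  have := subsingleton_dualSpace hA hn
  obtain ⟨V, -, hV⟩ := h
  rw [Subsingleton.elim V U, sub_self, norm_zero] at hV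
  exact lt_irrefl _ hV

/-- An iteration can be performed whenever the stopping test fails. -/
theorem exists_isStep (hA : Function.Surjective P.A) {U : ℕ → P.DualSpace} {α : ℕ → ℝ} {k : ℕ}
    (hU : U k ∈ P.dualFeasible) (hα : 0 < α k) (hc : P.Continues 0 (U k)) :
    ∃ (X : P.DualSpace) (a : ℝ), ∀ (U' : ℕ → P.DualSpace) (α' : ℕ → ℝ), (∀ i ≤ k, U' i = U i) →
      α' k = α k → U' (k + 1) = X → α' (k + 1) = a → P.IsStep par U' α' k := by
  have := neZero_of_continues hA hc
  obtain ⟨V, hV⟩ := exists_isProjOnto ⟨_, hU.1⟩ P.isClosed_calM P.convex_calM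
    (U k + α k • gradient P.g (U k))
  -- If the projection with step `α_k` fixes `U k`, then `U k` is stationary, so the projection with
  -- step `1` fixes it too, contrary to the failed stopping test.
  have hD : 0 < ‖V - U k‖ := by
    rw [norm_pos_iff, sub_ne_zero]
    rintro rfl
    obtain ⟨V₁, hV₁, hne⟩ := hc
    have h1 := hV.inner_le P.convex_calM hV₁.1
    rw [sub_self, inner_zero_right, norm_zero, mul_zero, zero_mul, add_zero] at h1
    rw [← one_smul ℝ (gradient P.g (U k))] at hV₁
    have h2 := hV₁.norm_sq_le P.convex_calM hU.1
    nlinarith [nonpos_of_mul_nonpos_right h1 hα]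
  obtain ⟨L, hL⟩ := Matrix.PosDef.exists_isCholesky hU.2
  obtain ⟨θ, hθ⟩ := ((symToMatrix_isHermitian (P.calB (V - U k))).whitening
    (L := L)).exists_isMinEigenvalue
  have hν := nuOf_pos par θ
  have hex : ∃ j, P.Armijo par U k (V - U k) (nuOf par θ) (par.β ^ j) := by
    obtain ⟨r, hr, hinc⟩ := exists_sufficient_increase P.isOpen_calN
      (isCompact_singleton (x := U k)) (Set.singleton_subset_iff.2 hU.2)
      (fun u hu => P.continuousAt_gradient_g hu)
      (fun u hu v hv => P.g_le_add_inner_gradient hu hv) hD hα par.γ_lt_one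
    obtain ⟨j, hj⟩ := exists_pow_lt_of_lt_one (div_pos hr (mul_pos hν hD)) par.β_lt_one
    rw [lt_div_iff₀ (mul_pos hν hD), ← mul_assoc] at hj
    have hβj : 0 < par.β ^ j := pow_pos par.β_pos j
    refine ⟨j, le_trans ?_ (hinc (U k) rfl (V - U k) (par.β ^ j * nuOf par θ) le_rfl
      (hV.norm_sq_le P.convex_calM hU.1) (by positivity) hj).2⟩
    rw [← mul_assoc par.γ]
    gcongr
    exact windowMin_le U k
  classical
  refine ⟨U k + (par.β ^ Nat.find hex * nuOf par θ) • (V - U k),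
    P.nextAlpha par (U k) (U k + (par.β ^ Nat.find hex * nuOf par θ) • (V - U k)),
    fun U' α' hU' hα' hX ha => ?_⟩
  have hk := hU' k le_rfl
  -- The test reads the sequence only up to index `k`, so the step transfers to any sequence with
  -- the same past.
  have hArm : ∀ σ, P.Armijo par U' k (V - U k) (nuOf par θ) σ ↔
      P.Armijo par U k (V - U k) (nuOf par θ) σ := by
    intro σ
    unfold Armijo
    rw [windowMin_congr hU', hk]
  refine ⟨V, V - U k, L, θ, nuOf par θ, Nat.find hex, ?_, ?_, ?_, hθ, rfl,
    (hArm _).2 (Nat.find_spec hex), fun i hi h => Nat.find_min hex hi ((hArm _).1 h), ?_, ?_⟩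
  · rwa [hk, hα']
  · rw [hk]
  · rwa [hk]
  · rw [hX, hk]
  · rw [ha, hX, hk]

theorem continues_of_not_stops {U : P.DualSpace} (hU : U ∈ P.dualFeasible) (h : ¬ P.Stops 0 U) :
    P.Continues 0 U := by
  obtain ⟨V, hV⟩ := exists_isProjOnto ⟨_, hU.1⟩ P.isClosed_calM P.convex_calM
    (U + gradient P.g U)
  exact ⟨V, hV, not_le.1 fun hle => h ⟨V, hV, hle⟩⟩

theorem exists_isRun (hA : Function.Surjective P.A) {U0 : P.DualSpace} {α0 : ℝ}
    (hU0 : U0 ∈ P.dualFeasible) (hα0 : α0 ∈ Set.Icc par.αmin par.αmax) :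
    ∃ (N : ℕ∞) (U : ℕ → P.DualSpace) (α : ℕ → ℝ), P.IsRun par 0 U0 α0 N U α := by
  classical
  let Good : ℕ → (ℕ → P.DualSpace × ℝ) → P.DualSpace × ℝ → Prop := fun k w x =>
    ∀ u : ℕ → P.DualSpace × ℝ, (∀ i ≤ k, u i = w i) → u (k + 1) = x →
      P.IsStep par (fun i => (u i).1) (fun i => (u i).2) k
  obtain ⟨u, hu0, hu⟩ := exists_seq_of_history (U0, α0)
    -- The recursion is total: when no step is possible it returns an irrelevant default. The run is
    -- later cut at the first index where the stopping test holds.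
    fun k w => if h : ∃ x, Good k w x then h.choose else (U0, α0)
  set U : ℕ → P.DualSpace := fun i => (u i).1 with hUdef
  set α : ℕ → ℝ := fun i => (u i).2 with hαdef
  have hU00 : U 0 = U0 := by rw [hUdef]; simp only [hu0]
  have hα00 : α 0 = α0 := by rw [hαdef]; simp only [hu0]
  have hstep : ∀ k, (∀ i ≤ k, P.Continues 0 (U i)) → P.IsStep par U α k := by
    intro k
    induction k using Nat.strong_induction_on with
    | _ k ih =>
      intro hc
      have hmem := mem_of_isStep (par := par) (U := U) (α := α) (by rwa [hU00]) (by rwa [hα00]) k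
        fun i hi => ih i hi fun j hj => hc j (by omega)
      obtain ⟨w, hw, hnext⟩ := hu k
      have hex : ∃ x, Good k w x := by
        obtain ⟨X, a, h⟩ := exists_isStep (par := par) hA (U := U) (α := α) hmem.1
          (par.αmin_pos.trans_le hmem.2.1.1) (hc k le_rfl)
        refine ⟨(X, a), fun v hv hx => h _ _ (fun i hi => ?_) ?_ ?_ ?_⟩
        · rw [hv i hi, hw i hi]
        · rw [hv k le_rfl, hw k le_rfl]
        · rw [hx]
        · rw [hx]
      rw [dif_pos hex] at hnext
      exact hex.choose_spec u (fun i hi => (hw i hi).symm) hnext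
  by_cases hterm : ∃ k, P.Stops 0 (U k)
  · have hc : ∀ k < Nat.find hterm, P.Continues 0 (U k) := by
      intro k
      induction k using Nat.strong_induction_on with
      | _ k ih =>
        intro hk
        have hmem := mem_of_isStep (par := par) (U := U) (α := α) (by rwa [hU00]) (by rwa [hα00]) k
          fun i hi => hstep i fun j hj => ih j (by omega) (by omega)
        exact continues_of_not_stops hmem.1 (Nat.find_min hterm hk)
    refine ⟨(Nat.find hterm : ℕ), U, α, hU00, hα00, fun k hk => hc k (by exact_mod_cast hk),
      fun k hk => hstep k fun i hi => hc i (lt_of_le_of_lt hi (by exact_mod_cast hk)),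
      fun k hk => ?_⟩
    rw [Nat.cast_inj.1 hk]
    exact Nat.find_spec hterm
  · have hc : ∀ k, P.Continues 0 (U k) := by
      intro k
      induction k using Nat.strong_induction_on with
      | _ k ih =>
        have hmem := mem_of_isStep (par := par) (U := U) (α := α) (by rwa [hU00]) (by rwa [hα00]) k
          fun i hi => hstep i fun j hj => ih j (by omega)
        exact continues_of_not_stops hmem.1 fun h => hterm ⟨k, h⟩
    exact ⟨⊤, U, α, hU00, hα00, fun k _ => hc k, fun k _ => hstep k fun i _ => hc i,
      fun k hk => absurd hk (ENat.natCast_ne_top k)⟩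

/-- Each iteration either increases the window minimum by a fixed amount or arrives at a nearly
optimal point. -/
theorem exists_uniform_progress {K : Set P.DualSpace} (hK : IsCompact K)
    (hKF : K ⊆ P.dualFeasible) {Ustar : P.DualSpace} (hstar : Ustar ∈ P.dualFeasible)
    {η : ℝ} (hη : 0 < η) :
    ∃ c > 0, ∀ (U : ℕ → P.DualSpace) (α : ℕ → ℝ) (k : ℕ), U k ∈ K →
      α k ∈ Set.Icc par.αmin par.αmax → P.IsStep par U α k →
      min (P.windowMin par U k + c) (P.g Ustar - 2 * η) ≤ P.g (U (k + 1)) := by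
  have hA := par.αmax_pos
  have ha := par.αmin_pos
  have hγ := par.γ_pos
  obtain ⟨Γ, hΓ⟩ := hK.exists_bound_of_continuousOn
    (fun u hu => (P.continuousAt_gradient_g (hKF hu).2).continuousWithinAt)
  obtain ⟨R, hR⟩ := hK.exists_bound_of_continuousOn (f := fun u => Ustar - u)
    (continuous_const.sub continuous_id).continuousOn
  set S := par.αmax * max Γ 0 + max R 0 + 1 with hS
  have hSpos : 0 < S := by positivity
  -- By `IsProjOnto.le_norm_mul`, the search direction has norm at least `c₁` at every point of `K`
  -- that is not `η`-optimal.
  set c₁ := par.αmin * η / S with hc₁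
  have hc₁pos : 0 < c₁ := by positivity
  obtain ⟨r, hr, hinc⟩ := exists_sufficient_increase P.isOpen_calN hK (fun u hu => (hKF hu).2)
    (fun u hu => P.continuousAt_gradient_g hu)
    (fun u hu v hv => P.g_le_add_inner_gradient hu hv) hc₁pos hA par.γ_lt_one
  obtain ⟨r₂, hr₂, hunif⟩ := Metric.mem_uniformity_dist.1
    (hK.uniformContinuousAt_of_continuousAt P.g (fun u hu => P.continuousAt_g (hKF hu).2)
      (Metric.dist_mem_uniformity hη))
  have hq : 0 < min par.τ par.β := lt_min par.τ_pos par.β_pos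
  -- The first two entries bound the predicted gain from below at points that are not `η`-optimal,
  -- one for each term of the step length bound. The third makes a step of smaller gain shorter than
  -- `r₂`.
  set δ₀ := min (min (c₁ ^ 2 / par.αmax) (min par.τ par.β * r * c₁ / (2 * par.αmax)))
    (r₂ ^ 2 / (2 * par.αmax)) with hδ₀
  have hδ₀pos : 0 < δ₀ := by positivity
  refine ⟨par.γ * δ₀, by positivity, fun U α k hUk hα hstep => ?_⟩
  have hUF := hKF hUk
  obtain ⟨V, t, hV, ht0, ht1, hnext, hF, hacc, hlow⟩ := hstep.exists_step_size hUF
  set x := inner ℝ (gradient P.g (U k)) (V - U k) with hx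
  have hx0 : 0 ≤ x :=
    nonneg_of_mul_nonneg_right ((sq_nonneg _).trans (hV.norm_sq_le P.convex_calM hUF.1))
      (ha.trans_le hα.1)
  have hDx : ‖V - U k‖ ^ 2 ≤ par.αmax * x :=
    (hV.norm_sq_le P.convex_calM hUF.1).trans (by gcongr; exact hα.2)
  rcases le_or_gt δ₀ (t * x) with hδ | hδ
  · refine (min_le_left _ _).trans (le_trans ?_ hacc)
    gcongr
  · refine (min_le_right _ _).trans ?_
    have hnear : P.g Ustar - η < P.g (U k) := by
      by_contra! hfar
      refine hδ.not_ge ?_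
      have h1 := P.g_le_add_inner_gradient hUF.2 hstar.2
      have h2 := hV.le_norm_mul P.convex_calM hstar.1 ha hα.1 hα.2 hη.le
        ((hΓ _ hUk).trans (le_max_left Γ 0)) ((hR _ hUk).trans (le_max_left R 0)) (by linarith)
      have h3 : c₁ ≤ ‖V - U k‖ := by
        rw [hc₁, div_le_iff₀ hSpos]
        refine h2.trans ?_
        gcongr
        linarith
      have hDpos := hc₁pos.trans_le h3
      have h4 := hlow r hr hDpos fun s hs hsr => hinc (U k) hUk (V - U k) s h3 hDx hs hsr
      have h5 : ‖V - U k‖ ^ 2 / par.αmax ≤ x := by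
        rw [div_le_iff₀ hA, mul_comm]
        exact hDx
      refine le_trans (b := min (c₁ ^ 2 / par.αmax)
        (min par.τ par.β * r * c₁ / (2 * par.αmax))) (min_le_left _ _) ?_
      refine le_trans ?_ (mul_le_mul h4 h5 (by positivity) ht0.le)
      rw [min_mul_of_nonneg (1 : ℝ) _ (by positivity)]
      refine min_le_min ?_ ?_
      · rw [one_mul]
        gcongr
      · have h6 : min par.τ par.β * (r / (2 * ‖V - U k‖)) * (‖V - U k‖ ^ 2 / par.αmax)
            = min par.τ par.β * r * ‖V - U k‖ / (2 * par.αmax) := by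
          field_simp
        rw [h6]
        gcongr
    have hshort : dist (U k) (U (k + 1)) < r₂ := by
      rw [hnext, dist_self_add_right, norm_smul, Real.norm_of_nonneg ht0.le]
      -- As `t ≤ 1` and `‖D‖² ≤ αmax x`, the squared step length is at most `αmax` times the gain `t
      -- x`.
      refine lt_of_pow_lt_pow_left₀ 2 hr₂.le ?_
      have h1 : t * x < r₂ ^ 2 / (2 * par.αmax) := hδ.trans_le (min_le_right _ _)
      rw [lt_div_iff₀ (by positivity)] at h1
      calc (t * ‖V - U k‖) ^ 2 = t * (t * ‖V - U k‖ ^ 2) := by ring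
        _ ≤ 1 * (t * (par.αmax * x)) := by gcongr
        _ ≤ t * x * (2 * par.αmax) := by nlinarith [mul_nonneg (mul_nonneg ht0.le hx0) hA.le]
        _ < r₂ ^ 2 := h1
    have h7 : dist (P.g (U k)) (P.g (U (k + 1))) < η := hunif hshort hUk
    rw [Real.dist_eq, abs_lt] at h7
    linarith

theorem exists_isGreatest_g (hA : Function.Surjective P.A)
    (hprimal : ∃ X : SymMat P.n, P.PrimalStrictlyFeasible X)
    (hdual : ∃ U : P.DualSpace, U ∈ P.dualFeasible) :
    ∃ Ustar ∈ P.dualFeasible, ∀ U ∈ P.dualFeasible, P.g U ≤ P.g Ustar := by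
  obtain ⟨U₁, hU₁⟩ := hdual
  obtain ⟨Ustar, hstar, hmax⟩ := (P.isCompact_superlevel hA hprimal (P.g U₁)).exists_isMaxOn
    ⟨U₁, hU₁, le_rfl⟩ (fun u hu => (P.continuousAt_g hu.1.2).continuousWithinAt)
  refine ⟨Ustar, hstar.1, fun U hU => ?_⟩
  rcases le_total (P.g U₁) (P.g U) with h | h
  · exact hmax ⟨hU, h⟩
  · exact h.trans hstar.2

end LogDetSDP

/-! ### Attainment and convergence. -/

theorem mainTheorem1 (P : LogDetSDP)
    (hA : Function.Surjective P.A)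
    (hprimal : ∃ X : SymMat P.n, P.PrimalStrictlyFeasible X)
    (hdual : ∃ U : P.DualSpace, U ∈ P.dualFeasible) :
    ∃ gstar : ℝ, IsGreatest (P.g '' P.dualFeasible) gstar ∧
      ∀ (par : DSPGParams) (U0 : P.DualSpace) (α0 : ℝ),
        U0 ∈ P.dualFeasible → α0 ∈ Set.Icc par.αmin par.αmax →
        (∃ (N : ℕ∞) (U : ℕ → P.DualSpace) (α : ℕ → ℝ), P.IsRun par 0 U0 α0 N U α) ∧
        ∀ (N : ℕ∞) (U : ℕ → P.DualSpace) (α : ℕ → ℝ), P.IsRun par 0 U0 α0 N U α →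
          (∀ k : ℕ, (k : ℕ∞) ≤ N → U k ∈ P.dualFeasible) ∧
          (∀ K : ℕ, (K : ℕ∞) = N → P.g (U K) = gstar) ∧
          (N = ⊤ → Filter.Tendsto (fun k => |P.g (U k) - gstar|) Filter.atTop (nhds 0)) := by
  obtain ⟨Ustar, hstar, hmax⟩ := LogDetSDP.exists_isGreatest_g hA hprimal hdual
  refine ⟨P.g Ustar, ⟨⟨Ustar, hstar, rfl⟩, ?_⟩, fun par U0 α0 hU0 hα0 =>
    ⟨LogDetSDP.exists_isRun hA hU0 hα0, fun N U α hrun => ?_⟩⟩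
  · rintro _ ⟨U, hU, rfl⟩
    exact hmax U hU
  have hmem : ∀ k : ℕ, (k : ℕ∞) ≤ N → U k ∈ P.dualFeasible ∧
      α k ∈ Set.Icc par.αmin par.αmax ∧ P.g (U 0) ≤ P.g (U k) := fun k hk =>
    LogDetSDP.mem_of_isStep (by rwa [hrun.init_U]) (by rwa [hrun.init_α]) k fun i hi =>
      hrun.step i (lt_of_lt_of_le (by exact_mod_cast hi) hk)
  refine ⟨fun k hk => (hmem k hk).1, fun K hK => ?_, ?_⟩
  · have hU := (hmem K hK.le).1
    refine le_antisymm (hmax _ hU) ?_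
    obtain ⟨V, hV, hle⟩ := hrun.stops K hK
    obtain rfl : V = U K := sub_eq_zero.1 (norm_le_zero_iff.1 hle)
    refine LogDetSDP.g_le_of_isProjOnto_self one_pos hU ?_ hstar
    rwa [one_smul]
  · rintro rfl
    have hmem' := fun k : ℕ => hmem k le_top
    rw [Metric.tendsto_atTop']
    intro ε hε
    obtain ⟨c, hc, hprog⟩ := LogDetSDP.exists_uniform_progress (par := par)
      (P.isCompact_superlevel hA hprimal (P.g (U 0))) (fun u hu => hu.1) hstar
      -- The values are eventually at least `g* - 2η = g* - ε / 2`, which leaves the strict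
      -- inequality required.
      (η := ε / 4) (by positivity)
    have hev := eventually_le_of_window (a := fun k => P.g (U k)) (M := par.M)
      (B := P.g Ustar - 2 * (ε / 4)) hc (fun k => (hmem' k).2.2) fun k b hb =>
        (min_le_min (add_le_add_left (LogDetSDP.le_windowMin hb) c) le_rfl).trans
          (hprog U α k ⟨(hmem' k).1, (hmem' k).2.2⟩ (hmem' k).2.1
            (hrun.step k (ENat.natCast_lt_top k)))
    obtain ⟨k₀, hk₀⟩ := Filter.eventually_atTop.1 hev
    refine ⟨k₀, fun k hk => ?_⟩
    have h1 := hk₀ k hk.le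
    have h2 := hmax _ (hmem' k).1
    rw [Real.dist_eq, sub_zero, abs_abs, abs_lt]
    constructor <;> linarith
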